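/- Let $N\ge 5$ be odd, let $\varepsilon>0$, and for $r\in\mathbb R$ consider the planar autonomous (co-moving) system $$\varepsilon\,\frac{dx_1}{dt}=w+x_1(x_1-1),\qquad \frac{dw}{dt}=-\sum_{n=1}^N x_1^n+r .$$ Put $r_c=\sum_{n=1}^N(1/2)^n$. Then: (i) For every $r\in\mathbb R$ the system has exactly one equilibrium $(x_1^*,w^*)$. (ii) The system undergoes a Hopf bifurcation at $r=r_c$, from the equilibrium $(x_1^*,w^*)=(1/2,1/4)$. That is: the equilibria form a smooth curve in $r$ near $r_c$; as $r$ passes through $r_c$, a pair of complex conjugate eigenvalues of the Jacobian at the equilibrium crosses the imaginary axis with nonzero speed, at $r=r_c$ these are simple and nonzero, and there are no other eigenvalues on the imaginary axis; and small nonconstant periodic orbits branch off from the equilibrium for $r>r_c$: for every neighborhood $U$ of $(1/2,1/4)$ there is $\delta>0$ such that for every $r\in(r_c,r_c+\delta)$ the system has a nonconstant periodic orbit contained in $U$. (iii) At $r=r_c$ the eigenvalues of the Jacobian at the equilibrium $(1/2,1/4)$ are $\pm i\sqrt{\frac1\varepsilon\sum_{n=1}^N n(1/2)^{n-1}}$.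 (iv) For every $r<r_c$ the equilibrium has $x_1^*<1/2$ and is asymptotically stable. -/

import Mathlib

open Filter Set
open scoped Topology ContDiff

section DynamicalSystems

variable {E : Type*} [NormedAddCommGroup E] [NormedSpace ℝ E]

/-- `x₀` is an asymptotically stable equilibrium of the autonomous system `x' = v x`: it is a
zero of `v`, it is Lyapunov stable (solutions starting nearby exist for all forward time and stay
nearby), and all solutions starting close enough to `x₀` converge to it. -/
structure IsAsymptoticallyStable (v : E → E) (x₀ : E) : Prop where
  equilibrium : v x₀ = 0
  stable : ∀ U ∈ 𝓝 x₀, ∃ V ∈ 𝓝 x₀, ∀ y ∈ V,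
    (∃ γ : ℝ → E, γ 0 = y ∧ IsIntegralCurveOn γ (fun _ => v) (Ici 0)) ∧
    ∀ γ : ℝ → E, γ 0 = y → IsIntegralCurveOn γ (fun _ => v) (Ici 0) → ∀ t, 0 ≤ t → γ t ∈ U
  attractive : ∃ V ∈ 𝓝 x₀, ∀ γ : ℝ → E, γ 0 ∈ V →
    IsIntegralCurveOn γ (fun _ => v) (Ici 0) → Tendsto γ atTop (𝓝 x₀)

/-- The autonomous system `x' = v x` has a nonconstant periodic orbit contained in `U`. -/
def HasPeriodicOrbitIn (v : E → E) (U : Set E) : Prop :=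
  ∃ (γ : ℝ → E) (T : ℝ), 0 < T ∧ IsIntegralCurve γ (fun _ => v) ∧ Function.Periodic γ T ∧
    (∃ t, γ t ≠ γ 0) ∧ ∀ t, γ t ∈ U

/-- The complex eigenvalues, with algebraic multiplicity, of the Jacobian of `v` at `x`. -/
noncomputable def jacobianEigenvalues [FiniteDimensional ℝ E] (v : E → E) (x : E) : Multiset ℂ :=
  ((LinearMap.charpoly (fderiv ℝ v x : E →ₗ[ℝ] E)).map (algebraMap ℝ ℂ)).roots

/-- The smooth one-parameter family `x' = f μ x` undergoes a (nondegenerate)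
Poincaré–Andronov–Hopf bifurcation at the parameter `μ₀` and the equilibrium `x₀`. -/
structure IsHopfBifurcation [FiniteDimensional ℝ E] (f : ℝ → E → E) (μ₀ : ℝ) (x₀ : E) :
    Prop where
  smooth : ContDiffAt ℝ ∞ (fun p : ℝ × E => f p.1 p.2) (μ₀, x₀)
  /-- Along a smooth branch of equilibria, an eigenvalue of the Jacobian (and hence also its
  complex conjugate) crosses the imaginary axis with nonzero speed at a point `b i` with `b > 0`.
  At `μ₀` the eigenvalues `± b i` are simple and there are no others on the imaginary axis. -/
  crossing : ∃ (b : ℝ) (x : ℝ → E) (ev : ℝ → ℂ) (ev' : ℂ), 0 < b ∧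
    x μ₀ = x₀ ∧ ContDiffAt ℝ ∞ x μ₀ ∧ (∀ᶠ μ in 𝓝 μ₀, f μ (x μ) = 0) ∧
    ev μ₀ = b * Complex.I ∧ (∀ᶠ μ in 𝓝 μ₀, ev μ ∈ jacobianEigenvalues (f μ) (x μ)) ∧
    HasDerivAt ev ev' μ₀ ∧ ev'.re ≠ 0 ∧
    (jacobianEigenvalues (f μ₀) x₀).count (b * Complex.I) = 1 ∧
    (jacobianEigenvalues (f μ₀) x₀).count (-(b * Complex.I)) = 1 ∧
    ∀ z ∈ jacobianEigenvalues (f μ₀) x₀, z.re = 0 → z = b * Complex.I ∨ z = -(b * Complex.I)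
  /-- Periodic orbits branch off from the equilibrium on one side of `μ₀`: in each neighborhood
  of `x₀` there is one for every parameter that is close enough to `μ₀` on that side. -/
  periodic_orbits :
    (∀ U ∈ 𝓝 x₀, ∀ᶠ μ in 𝓝[>] μ₀, HasPeriodicOrbitIn (f μ) U) ∨
    (∀ U ∈ 𝓝 x₀, ∀ᶠ μ in 𝓝[<] μ₀, HasPeriodicOrbitIn (f μ) U)

end DynamicalSystems

/-- The vector field of the co-moving system
`ε x₁' = w + x₁ (x₁ - 1)`, `w' = -∑ₙ x₁ⁿ + r` (sum over `1 ≤ n ≤ N`) at the point `(x₁, w)`. -/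
noncomputable def coMovingField (N : ℕ) (ε r : ℝ) (p : ℝ × ℝ) : ℝ × ℝ :=
  ((p.2 + p.1 * (p.1 - 1)) / ε, -(∑ n ∈ Finset.Icc 1 N, p.1 ^ n) + r)

/-- The critical rate `∑ₙ (1/2)ⁿ` (sum over `1 ≤ n ≤ N`). -/
noncomputable def criticalRate (N : ℕ) : ℝ := ∑ n ∈ Finset.Icc 1 N, (1 / 2 : ℝ) ^ n

/-!
Relative to its equilibrium `(x, x (1 - x))` the co-moving system with rate `r = ∑ₙ xⁿ` is a Liénard
system `ε u' = v + u² + m u`, `v' = -u g(u)`, where `m = 2 x - 1` and `g` is the difference quotient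
of the rate (`coMovingField_add`). For odd `N` the rate is a strictly increasing bijection of the
line with positive derivative, so that there is one equilibrium for each rate, depending smoothly on
it, and `m` changes sign at the critical rate. The Jacobian has trace `m / ε` and determinant
`g 0 / ε > 0`, which gives the crossing of the eigenvalues.

Stability for `m < 0` follows from Lyapunov's theorem (`isAsymptoticallyStable_of_lyapunov`) with a
quadratic form whose derivative along the field is definite with the sign of `m`
(`exists_lienardQuadratic_bounds`).

The periodic orbits for small `m > 0` are found between a repelling equilibrium and an attracting
level curve. For `m = 0` and `g u = a + b u + O(u²)` with `b > 0` there is a polynomial `L` of degree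
four that is positive and strictly decreases along the field near the origin
(`exists_lienardQuartic_bounds`); this replaces the computation of the first Lyapunov coefficient.
By compactness, `L` still decreases along the field on a fixed small level curve when `m` is slightly
positive, while the quadratic form increases near the origin. As the field rotates around the
origin, its orbits are graphs of the logarithm of the polar radius over the angle, and these graphs
solve a scalar equation; the return map after one revolution is continuous, moves a point
near the origin outwards and a point of the level curve inwards, and hence has a fixed point
(`hasPeriodicOrbitIn_of_clockwise`). Changing time turns the closed curve into a periodic orbit
(`HasPeriodicOrbitIn.of_time_change`).
-/

/-! ### Solutions on half-lines and trapping regions -/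

section ODE

variable {E : Type*} [NormedAddCommGroup E] [NormedSpace ℝ E]

/-- A bounded, globally Lipschitz autonomous vector field has solutions for all forward time: the
Picard–Lindelöf solutions on `[0, T]`, which exist for every `T` since the field is bounded, agree
with each other by uniqueness. -/
theorem exists_isIntegralCurveOn_Ici_of_lipschitzWith [CompleteSpace E] {v : E → E} {K M : NNReal}
    (hK : LipschitzWith K v) (hM : ∀ x, ‖v x‖ ≤ M) (x : E) :
    ∃ γ : ℝ → E, γ 0 = x ∧ IsIntegralCurveOn γ (fun _ => v) (Ici 0) := by
  have key : ∀ n : ℕ, ∃ γ : ℝ → E, γ 0 = x ∧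
      ∀ t ∈ Icc (0 : ℝ) n, HasDerivWithinAt γ (v (γ t)) (Icc 0 n) t := by
    intro n
    have hpl : IsPicardLindelof (fun _ => v) (tmin := 0) (tmax := n)
        ⟨0, left_mem_Icc.2 n.cast_nonneg⟩ x (M * n) 0 M K :=
      { lipschitzOnWith := fun t _ => hK.lipschitzOnWith
        continuousOn := fun _ _ => continuousOn_const
        norm_le := fun _ _ y _ => hM y
        mul_max_le := by simp }
    exact hpl.exists_eq_forall_mem_Icc_hasDerivWithinAt₀
  choose γ hγ0 hγ using key
  have heq : ∀ m n : ℕ, m ≤ n → EqOn (γ m) (γ n) (Icc 0 m) := by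
    intro m n hmn
    have hmn' : (m : ℝ) ≤ n := by exact_mod_cast hmn
    refine ODE_solution_unique (v := fun _ => v) (K := K) (fun _ => hK)
      (fun t ht => (hγ m t ht).continuousWithinAt) ?_
      (fun t ht => ((hγ n t ⟨ht.1, ht.2.trans hmn'⟩).continuousWithinAt).mono
        (Icc_subset_Icc_right hmn')) ?_ (by rw [hγ0, hγ0])
    · intro t ht
      exact (hγ m t ⟨ht.1, ht.2.le⟩).mono_of_mem_nhdsWithin (Icc_mem_nhdsGE_of_mem ht)
    · intro t ht
      exact (hγ n t ⟨ht.1, ht.2.le.trans hmn'⟩).mono_of_mem_nhdsWithin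
        (Icc_mem_nhdsGE_of_mem ⟨ht.1, ht.2.trans_le hmn'⟩)
  -- At time `t` the solution is read off from an interval that contains a neighbourhood of `t`.
  refine ⟨fun t => γ (⌈t⌉₊ + 1) t, by simp [hγ0], fun t ht => ?_⟩
  have ht0 : (0 : ℝ) ≤ t := ht
  have hceil : t < ((⌈t⌉₊ + 1 : ℕ) : ℝ) := by
    push_cast
    linarith [Nat.le_ceil t]
  have hd := hγ (⌈t⌉₊ + 1) t ⟨ht0, hceil.le⟩
  have hd' : HasDerivWithinAt (γ (⌈t⌉₊ + 1)) (v (γ (⌈t⌉₊ + 1) t)) (Ici 0) t := by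
    refine hd.mono_of_mem_nhdsWithin ?_
    rw [← Ici_inter_Iic]
    exact inter_mem self_mem_nhdsWithin (mem_nhdsWithin_of_mem_nhds (Iic_mem_nhds hceil))
  refine hd'.congr_of_eventuallyEq ?_ rfl
  filter_upwards [self_mem_nhdsWithin, mem_nhdsWithin_of_mem_nhds (Iio_mem_nhds hceil)]
    with s hs0 hs
  have hs0 : (0 : ℝ) ≤ s := hs0
  have hs' : s ≤ ((⌈s⌉₊ + 1 : ℕ) : ℝ) := by
    push_cast
    linarith [Nat.le_ceil s]
  rcases le_total (⌈s⌉₊ + 1) (⌈t⌉₊ + 1) with h | h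
  · exact heq _ _ h ⟨hs0, hs'⟩
  · exact (heq _ _ h ⟨hs0, le_of_lt hs⟩).symm

/-- A curve cannot leave the part of `K` where `L ≤ c` if this part lies in the interior of `K` and
`L` strictly decreases along the curve whenever the curve is on the level `c`. -/
theorem mem_sublevel_of_trapping {X : Type*} [TopologicalSpace X] {γ : ℝ → X} {L : X → ℝ}
    {K : Set X} {c a b : ℝ}
    (hK : IsClosed K) (hL : Continuous L) (hγ : ContinuousOn γ (Icc a b))
    (hint : ∀ p ∈ K, L p ≤ c → K ∈ 𝓝 p) (h0 : γ a ∈ K ∧ L (γ a) ≤ c)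
    (hder : ∀ t ∈ Ico a b, γ t ∈ K → L (γ t) = c →
      ∃ d < 0, HasDerivWithinAt (fun s => L (γ s)) d (Ici t) t) :
    ∀ t ∈ Icc a b, γ t ∈ K ∧ L (γ t) ≤ c := by
  have hclosed : IsClosed ({t | γ t ∈ K ∧ L (γ t) ≤ c} ∩ Icc a b) := by
    have h1 : IsClosed (K ∩ L ⁻¹' Iic c) := hK.inter (isClosed_Iic.preimage hL)
    have h2 := hγ.preimage_isClosed_of_isClosed isClosed_Icc h1
    rwa [inter_comm] at h2
  refine hclosed.Icc_subset_of_forall_mem_nhdsWithin h0 ?_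
  rintro t ⟨⟨htK, htc⟩, ht⟩
  have hcont : ContinuousWithinAt γ (Ioi t) t :=
    ((hγ t ⟨ht.1, ht.2.le⟩).mono_of_mem_nhdsWithin (Icc_mem_nhdsGE_of_mem ht)).mono
      Ioi_subset_Ici_self
  have hKev : ∀ᶠ s in 𝓝[>] t, γ s ∈ K := hcont (hint _ htK htc)
  rcases htc.lt_or_eq with hlt | heq
  · have : ∀ᶠ s in 𝓝[>] t, L (γ s) < c :=
      (hL.continuousAt.comp_continuousWithinAt hcont).eventually_lt_const hlt
    filter_upwards [hKev, this] with s h1 h2 using ⟨h1, h2.le⟩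
  · obtain ⟨d, hd, hder⟩ := hder t ht htK heq
    have hs := (hasDerivWithinAt_iff_tendsto_slope' (self_notMem_Ioi)).1 hder.Ioi_of_Ici
    filter_upwards [hKev, hs.eventually_lt_const hd, self_mem_nhdsWithin] with s h1 h2 h3
    refine ⟨h1, ?_⟩
    have h3 : t < s := h3
    rw [slope_def_field, div_lt_iff₀ (sub_pos.2 h3), zero_mul] at h2
    linarith

/-! ### Periodic orbits -/

/-- The periodic extension of a solution of a `T`-periodic equation on `[0, T]` with equal values at
the end points is a solution on the whole line. -/
theorem exists_periodic_of_hasDerivWithinAt_Icc {f : ℝ → E} {G : ℝ → E → E} {T : ℝ} (hT : 0 < T)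
    (hG : ∀ t x, G (t + T) x = G t x)
    (hf : ∀ t ∈ Icc 0 T, HasDerivWithinAt f (G t (f t)) (Icc 0 T) t) (h0 : f 0 = f T) :
    ∃ g : ℝ → E, Function.Periodic g T ∧ (∀ t, HasDerivAt g (G t (g t)) t) ∧
      EqOn g f (Icc 0 T) := by
  set g : ℝ → E := fun t => f (toIcoMod hT 0 t) with hg
  have hper : Function.Periodic g T := fun t => by simp [hg]
  have heq : EqOn g f (Icc 0 T) := by
    intro t ht
    rcases ht.2.lt_or_eq with h | h
    · have : toIcoMod hT 0 t = t := (toIcoMod_eq_self hT).2 ⟨ht.1, by simpa using h⟩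
      simp [hg, this]
    · have : toIcoMod hT 0 T = 0 := by
        have := toIcoMod_add_right hT 0 0
        simpa using this
      simp [hg, h, this, h0]
  have hIcc : ∀ t ∈ Icc 0 T, HasDerivWithinAt g (G t (g t)) (Icc 0 T) t := fun t ht => by
    rw [heq ht]
    exact (hf t ht).congr heq (heq ht)
  have hIco : ∀ t ∈ Ico 0 T, HasDerivAt g (G t (g t)) t := by
    intro t ht
    rcases ht.1.eq_or_lt with h | h
    · -- At the seam the left derivative is the one at the end of the interval.
      subst h
      have hr : HasDerivWithinAt g (G 0 (g 0)) (Ici 0) 0 :=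
        (hIcc 0 (left_mem_Icc.2 hT.le)).mono_of_mem_nhdsWithin (Icc_mem_nhdsGE hT)
      have hl : HasDerivWithinAt g (G 0 (g 0)) (Iic 0) 0 := by
        have h1 : HasDerivWithinAt g (G T (g T)) (Iic T) T :=
          (hIcc T (right_mem_Icc.2 hT.le)).mono_of_mem_nhdsWithin (Icc_mem_nhdsLE hT)
        have hGT : G T (g T) = G 0 (g 0) := by
          have e1 := hG 0 (g T)
          have e2 := hper 0
          rw [zero_add] at e1 e2
          rw [e1, e2]
        rw [hGT] at h1
        have h2 : HasDerivWithinAt (fun s : ℝ => s + T) 1 (Iic 0) 0 :=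
          ((hasDerivAt_id (0 : ℝ)).add_const T).hasDerivWithinAt
        have h1' : HasDerivWithinAt g (G 0 (g 0)) (Iic T) ((fun s : ℝ => s + T) 0) := by
          simpa using h1
        have h3 := h1'.scomp (0 : ℝ) h2 (fun s hs => by
          have hs : s ≤ 0 := hs
          change s + T ≤ T
          linarith)
        have h4 : g ∘ (fun s : ℝ => s + T) = g := funext fun s => hper s
        rw [h4, one_smul] at h3
        exact h3
      have := hl.union hr
      rwa [Iic_union_Ici, hasDerivWithinAt_univ] at this
    · exact (hIcc t ⟨ht.1, ht.2.le⟩).hasDerivAt (Icc_mem_nhds h ht.2)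
  have hGz : ∀ (n : ℤ) t x, G (t + n • T) x = G t x := fun n t x =>
    (show Function.Periodic (fun t => G t x) T from fun t => hG t x).zsmul n t
  refine ⟨g, hper, fun t => ?_, heq⟩
  set n := toIcoDiv hT 0 t
  have hmem : t - n • T ∈ Ico 0 T := by
    have := sub_toIcoDiv_zsmul_mem_Ico hT 0 t
    rwa [zero_add] at this
  have h1 := hIco _ hmem
  have hgt : g (t - n • T) = g t := hper.sub_zsmul_eq n
  have hGt : G (t - n • T) (g t) = G t (g t) := by
    have := hGz n (t - n • T) (g t)
    rw [sub_add_cancel] at this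
    exact this.symm
  rw [hgt, hGt] at h1
  have h3 := h1.scomp t ((hasDerivAt_id t).sub_const (n • T))
  have h4 : (g ∘ fun s => id s - n • T) = g := funext fun s => hper.sub_zsmul_eq n
  rwa [h4, one_smul] at h3

/-- A closed curve tangent to a vector field with positive, periodic speed factor is, up to a
change of time, a periodic orbit. -/
theorem HasPeriodicOrbitIn.of_time_change {v : E → E} {U : Set E} {p : ℝ → E} {l : ℝ → ℝ} {T : ℝ}
    (hT : 0 < T) (hp : Function.Periodic p T) (hl : Function.Periodic l T) (hlc : Continuous l)
    (hlpos : ∀ s, 0 < l s) (hder : ∀ s, HasDerivAt p (l s • v (p s)) s)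
    (hne : ∃ s, p s ≠ p 0) (hU : ∀ s, p s ∈ U) : HasPeriodicOrbitIn v U := by
  -- `τ` is the time as a function of the parameter.
  set τ : ℝ → ℝ := fun s => ∫ x in (0 : ℝ)..s, l x with hτ
  have hτd : ∀ s, HasDerivAt τ (l s) s := fun s =>
    intervalIntegral.integral_hasDerivAt_right (hlc.intervalIntegrable _ _)
      (hlc.stronglyMeasurableAtFilter _ _) hlc.continuousAt
  have hmono : StrictMono τ := strictMono_of_deriv_pos fun s => by
    rw [(hτd s).deriv]
    exact hlpos s
  have hτ0 : τ 0 = 0 := by simp [hτ]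
  have hadd : ∀ s, τ (s + T) = τ s + τ T := by
    intro s
    have h1 : τ (s + T) = τ s + ∫ x in s..(s + T), l x :=
      (intervalIntegral.integral_add_adjacent_intervals (hlc.intervalIntegrable _ _)
        (hlc.intervalIntegrable _ _)).symm
    have h2 := hl.intervalIntegral_add_eq s 0
    rw [zero_add] at h2
    rw [h1, h2]
  have hτT : 0 < τ T := by
    have := hmono hT
    rwa [hτ0] at this
  have hcont : Continuous τ := continuous_iff_continuousAt.2 fun s => (hτd s).continuousAt
  have hnat : ∀ n : ℕ, τ (n * T) = n * τ T := by
    intro n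
    induction n with
    | zero => simp [hτ0]
    | succ n ih =>
      have := hadd (n * T)
      rw [ih] at this
      push_cast
      rw [add_mul, one_mul, this]
      ring
  have hnat' : ∀ n : ℕ, τ (-(n * T)) = -(n * τ T) := by
    intro n
    induction n with
    | zero => simp [hτ0]
    | succ n ih =>
      have := hadd (-((n + 1 : ℕ) * T))
      have h2 : -(((n + 1 : ℕ) : ℝ) * T) + T = -(n * T) := by push_cast; ring
      rw [h2, ih] at this
      push_cast at this ⊢
      linarith
  have hsurj : Function.Surjective τ := by
    intro y
    obtain ⟨n, hn⟩ := exists_nat_gt (|y| / τ T)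
    rw [div_lt_iff₀ hτT] at hn
    have h1 : τ (-(n * T)) ≤ y := by
      rw [hnat']
      linarith [neg_abs_le y]
    have h2 : y ≤ τ (n * T) := by
      rw [hnat]
      linarith [le_abs_self y]
    obtain ⟨s, -, hs⟩ := intermediate_value_Icc
      (show -(n * T) ≤ n * T by nlinarith [(n.cast_nonneg : (0 : ℝ) ≤ n)]) hcont.continuousOn ⟨h1, h2⟩
    exact ⟨s, hs⟩
  set e := hmono.orderIsoOfSurjective τ hsurj with he
  have hee : ∀ s, e s = τ s := fun s => rfl
  have hright : ∀ t, τ (e.symm t) = t := fun t => e.apply_symm_apply t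
  have hsym : ∀ t, HasDerivAt e.symm (l (e.symm t))⁻¹ t := fun t =>
    HasDerivAt.of_local_left_inverse e.symm.continuous.continuousAt (hτd _) (hlpos _).ne'
      (Eventually.of_forall hright)
  have hsymT : ∀ t, e.symm (t + τ T) = e.symm t + T := by
    intro t
    rw [e.symm_apply_eq, hee, hadd, hright]
  refine ⟨fun t => p (e.symm t), τ T, hτT, ?_, ?_, ?_, fun t => hU _⟩
  · intro t
    have h := (hder (e.symm t)).scomp t (hsym t)
    rwa [smul_smul, inv_mul_cancel₀ (hlpos _).ne', one_smul] at h
  · intro t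
    change p (e.symm (t + τ T)) = p (e.symm t)
    rw [hsymT, hp]
  · obtain ⟨s, hs⟩ := hne
    refine ⟨τ s, ?_⟩
    have h1 : e.symm (τ s) = s := e.symm_apply_apply s
    have h2 : e.symm 0 = 0 := by
      rw [e.symm_apply_eq, hee, hτ0]
    simpa only [h1, h2] using hs

theorem HasPeriodicOrbitIn.translate {v w : E → E} {U W : Set E} (q : E)
    (h : HasPeriodicOrbitIn v U) (hv : ∀ p, w (q + p) = v p) (hU : ∀ p ∈ U, q + p ∈ W) :
    HasPeriodicOrbitIn w W := by
  obtain ⟨γ, T, hT, hγ, hper, ⟨t, ht⟩, hγU⟩ := h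
  refine ⟨fun t => q + γ t, T, hT, fun s => ?_, fun s => ?_, ⟨t, ?_⟩, fun s => hU _ (hγU s)⟩
  · change HasDerivAt (fun t => q + γ t) (w (q + γ s)) s
    rw [hv]
    exact (hγ s).const_add q
  · change q + γ (s + T) = q + γ s
    rw [hper]
  · simpa using ht

end ODE

/-! ### Asymptotic stability from a Lyapunov function -/

section Lyapunov

variable {E : Type*} [NormedAddCommGroup E] [NormedSpace ℝ E] {v : E → E} {V : E → ℝ} {q : E}
  {k κ R : ℝ}

/-- A solution that starts in the ball below the minimum of the Lyapunov function on the boundary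
sphere never leaves the ball. -/
theorem mem_closedBall_of_lyapunov (hV : Differentiable ℝ V) (hk : 0 < k) (hκ : 0 < κ)
    (hR : 0 < R) (hlow : ∀ p ∈ Metric.closedBall q R, k * ‖p - q‖ ^ 2 ≤ V p)
    (hdec : ∀ p ∈ Metric.closedBall q R, fderiv ℝ V p (v p) ≤ -κ * V p) {γ : ℝ → E}
    (hγ : IsIntegralCurveOn γ (fun _ => v) (Ici 0)) (h0 : γ 0 ∈ Metric.closedBall q R)
    (h0' : V (γ 0) ≤ k * R ^ 2 / 2) {t : ℝ} (ht : 0 ≤ t) : γ t ∈ Metric.closedBall q R := by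
  refine (mem_sublevel_of_trapping (L := V) (c := k * R ^ 2 / 2) (a := 0) (b := t)
    Metric.isClosed_closedBall hV.continuous (hγ.continuousOn.mono Icc_subset_Ici_self) ?_
    ⟨h0, h0'⟩ ?_ t ⟨ht, le_rfl⟩).1
  · intro p hp hpc
    refine mem_of_superset (Metric.isOpen_ball.mem_nhds ?_) Metric.ball_subset_closedBall
    have h1 := hlow p hp
    rw [mem_ball_iff_norm]
    have h2 : ‖p - q‖ ^ 2 < R ^ 2 := by
      have : 0 < k * R ^ 2 := by positivity
      refine lt_of_mul_lt_mul_left (a := k) ?_ hk.le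
      linarith
    exact lt_of_pow_lt_pow_left₀ 2 hR.le h2
  · intro s hs hsK hsc
    refine ⟨_, ?_, ((hV (γ s)).hasFDerivAt.comp_hasDerivWithinAt s (hγ s hs.1)).mono
      (Ici_subset_Ici.2 hs.1)⟩
    have h1 := hdec _ hsK
    have h2 : 0 < κ * (k * R ^ 2 / 2) := by positivity
    rw [hsc] at h1
    linarith

/-- Lyapunov's theorem with a strict Lyapunov function that is bounded below by a multiple of the
squared distance and decays exponentially along the field. -/
theorem isAsymptoticallyStable_of_lyapunov [FiniteDimensional ℝ E] (hv : ContDiff ℝ 1 v)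
    (hq : v q = 0) (hV : Differentiable ℝ V) (hVq : V q = 0) (hk : 0 < k) (hκ : 0 < κ)
    (hR : 0 < R) (hlow : ∀ p ∈ Metric.closedBall q R, k * ‖p - q‖ ^ 2 ≤ V p)
    (hdec : ∀ p ∈ Metric.closedBall q R, fderiv ℝ V p (v p) ≤ -κ * V p) :
    IsAsymptoticallyStable v q := by
  have hnhds : ∀ r > 0, {p | p ∈ Metric.closedBall q r ∧ V p ≤ k * r ^ 2 / 2} ∈ 𝓝 q := by
    intro r hr
    refine inter_mem (Metric.closedBall_mem_nhds q hr) ?_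
    have : ∀ᶠ p in 𝓝 q, V p < k * r ^ 2 / 2 :=
      hV.continuous.continuousAt.eventually_lt_const (by rw [hVq]; positivity)
    filter_upwards [this] with p hp using hp.le
  refine ⟨hq, fun U hU => ?_, ?_⟩
  · obtain ⟨r₀, hr₀, hr₀U⟩ := Metric.nhds_basis_closedBall.mem_iff.1 hU
    set r := min r₀ R
    have hr : 0 < r := lt_min hr₀ hR
    have hrR : Metric.closedBall q r ⊆ Metric.closedBall q R :=
      Metric.closedBall_subset_closedBall (min_le_right _ _)
    refine ⟨_, hnhds r hr, fun y hy => ⟨?_, fun γ hγ0 hγ t ht => ?_⟩⟩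
    · -- Cut the field off outside the ball to make it bounded and Lipschitz.
      let χ : ContDiffBump q := ⟨r, r + 1, hr, by linarith⟩
      set w : E → E := fun p => χ p • v p with hw
      have hws : ContDiff ℝ 1 w := χ.contDiff.smul hv
      have hwc : HasCompactSupport w := χ.hasCompactSupport.smul_right
      obtain ⟨K, hK⟩ := hws.lipschitzWith_of_hasCompactSupport hwc one_ne_zero
      obtain ⟨M, hM⟩ := hwc.exists_bound_of_continuous hws.continuous
      have hwv : ∀ p ∈ Metric.closedBall q r, w p = v p := fun p hp => by
        simp [hw, χ.one_of_mem_closedBall hp]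
      obtain ⟨γ, hγ0, hγ⟩ := exists_isIntegralCurveOn_Ici_of_lipschitzWith hK (M := M.toNNReal)
        (fun x => (hM x).trans (Real.le_coe_toNNReal M)) y
      refine ⟨γ, hγ0, fun t ht => ?_⟩
      have hmem : γ t ∈ Metric.closedBall q r := by
        refine mem_closedBall_of_lyapunov hV hk hκ hr (fun p hp => hlow p (hrR hp))
          (fun p hp => ?_) hγ (hγ0 ▸ hy.1) (hγ0 ▸ hy.2) ht
        rw [hwv p hp]
        exact hdec p (hrR hp)
      have := hγ t ht
      simp only [hwv _ hmem] at this
      exact this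
    · refine hr₀U (Metric.closedBall_subset_closedBall (min_le_left r₀ R) ?_)
      exact mem_closedBall_of_lyapunov hV hk hκ hr (fun p hp => hlow p (hrR hp))
        (fun p hp => hdec p (hrR hp)) hγ (hγ0 ▸ hy.1) (hγ0 ▸ hy.2) ht
  · refine ⟨_, hnhds R hR, fun γ h0 hγ => ?_⟩
    have hmem : ∀ t, 0 ≤ t → γ t ∈ Metric.closedBall q R := fun t ht =>
      mem_closedBall_of_lyapunov hV hk hκ hR hlow hdec hγ h0.1 h0.2 ht
    have hanti : AntitoneOn (fun t => Real.exp (κ * t) * V (γ t)) (Ici 0) := by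
      have hd : ∀ t ∈ Ici (0 : ℝ), HasDerivWithinAt (fun t => Real.exp (κ * t) * V (γ t))
          (Real.exp (κ * t) * (κ * 1) * V (γ t) + Real.exp (κ * t) * fderiv ℝ V (γ t) (v (γ t)))
          (Ici 0) t := fun t ht =>
        ((((hasDerivAt_id t).const_mul κ).exp).hasDerivWithinAt).mul
          ((hV (γ t)).hasFDerivAt.comp_hasDerivWithinAt t (hγ t ht))
      refine antitoneOn_of_hasDerivWithinAt_nonpos (convex_Ici 0)
        (fun t ht => (hd t ht).continuousWithinAt)
        (fun t ht => (hd t (interior_subset ht)).mono interior_subset) fun t ht => ?_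
      have h1 := hdec _ (hmem t (interior_subset ht))
      have h2 := Real.exp_pos (κ * t)
      nlinarith
    rw [tendsto_iff_norm_sub_tendsto_zero]
    have hsq : Tendsto (fun t => ‖γ t - q‖ ^ 2) atTop (𝓝 0) := by
      have hlim : Tendsto (fun t => V (γ 0) / k * Real.exp (-(κ * t))) atTop (𝓝 0) := by
        have : Tendsto (fun t : ℝ => Real.exp (-(κ * t))) atTop (𝓝 0) :=
          Real.tendsto_exp_neg_atTop_nhds_zero.comp (tendsto_id.const_mul_atTop hκ)
        simpa using this.const_mul (V (γ 0) / k)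
      refine squeeze_zero' (Eventually.of_forall fun t => by positivity) ?_ hlim
      filter_upwards [eventually_ge_atTop 0] with t ht
      have h1 := hanti (mem_Ici.2 le_rfl) ht ht
      have h2 := hlow _ (hmem t ht)
      simp only [mul_zero, Real.exp_zero, one_mul] at h1
      rw [Real.exp_neg, div_mul_eq_mul_div, le_div_iff₀ hk, ← div_eq_mul_inv,
        le_div_iff₀ (Real.exp_pos _)]
      have h3 := Real.exp_pos (κ * t)
      nlinarith
    have := hsq.sqrt
    simpa [Real.sqrt_sq] using this

end Lyapunov

/-! ### Periodic orbits between an expanding and a contracting level -/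

/-- The point with polar radius `ρ` and polar angle `-θ`: the angle is measured clockwise. -/
noncomputable def clockwisePolar (θ ρ : ℝ) : ℝ × ℝ := (ρ * Real.cos θ, -(ρ * Real.sin θ))

theorem clockwisePolar_sq_add_sq (θ ρ : ℝ) :
    (clockwisePolar θ ρ).1 ^ 2 + (clockwisePolar θ ρ).2 ^ 2 = ρ ^ 2 := by
  have := Real.sin_sq_add_cos_sq θ
  simp only [clockwisePolar]
  linear_combination ρ ^ 2 * this

/-- If `σ` solves the equation for the logarithm of the polar radius as a function of the angle,
the corresponding curve is tangent to the vector field. -/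
theorem hasDerivWithinAt_clockwisePolar {Y : ℝ × ℝ → ℝ × ℝ} {A W : ℝ → ℝ → ℝ} {σ : ℝ → ℝ}
    {s : Set ℝ} {θ : ℝ}
    (hY : ∀ θ ρ, Y (clockwisePolar θ ρ) = (ρ * (A θ ρ * Real.cos θ - W θ ρ * Real.sin θ),
      -(ρ * (A θ ρ * Real.sin θ + W θ ρ * Real.cos θ))))
    (hW : W θ (Real.exp (σ θ)) ≠ 0)
    (hσ : HasDerivWithinAt σ (A θ (Real.exp (σ θ)) / W θ (Real.exp (σ θ))) s θ) :
    HasDerivWithinAt (fun θ => clockwisePolar θ (Real.exp (σ θ)))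
      ((W θ (Real.exp (σ θ)))⁻¹ • Y (clockwisePolar θ (Real.exp (σ θ)))) s θ := by
  have h1 := hσ.exp.mul (Real.hasDerivAt_cos θ).hasDerivWithinAt
  have h2 := (hσ.exp.mul (Real.hasDerivAt_sin θ).hasDerivWithinAt).neg
  refine (h1.prodMk h2).congr_deriv ?_
  rw [hY]
  ext
  · simp only [Prod.smul_fst, smul_eq_mul]
    field_simp
    ring
  · simp only [Prod.smul_snd, smul_eq_mul]
    field_simp

/-- A planar vector field that turns clockwise in a punctured disc has a periodic orbit in this disc
if a function `L` decreases along it on a closed level curve around the origin and a function `V`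
does not decrease along it near the origin. The return map to the positive horizontal half-axis
then moves a point of the level curve inwards and a point near the origin outwards, so that it has
a fixed point in between. -/
theorem hasPeriodicOrbitIn_of_clockwise {Y : ℝ × ℝ → ℝ × ℝ} {A W : ℝ → ℝ → ℝ} {R : ℝ} (hR : 0 < R)
    (hA : ContDiff ℝ 1 (Function.uncurry A)) (hW : ContDiff ℝ 1 (Function.uncurry W))
    (hAper : ∀ θ ρ, A (θ + 2 * Real.pi) ρ = A θ ρ) (hWper : ∀ θ ρ, W (θ + 2 * Real.pi) ρ = W θ ρ)
    (hWpos : ∀ θ, ∀ ρ ∈ Icc 0 R, 0 < W θ ρ)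
    (hY : ∀ θ ρ, Y (clockwisePolar θ ρ) = (ρ * (A θ ρ * Real.cos θ - W θ ρ * Real.sin θ),
      -(ρ * (A θ ρ * Real.sin θ + W θ ρ * Real.cos θ))))
    {L V : ℝ × ℝ → ℝ} (hL : Differentiable ℝ L) (hV : Differentiable ℝ V) {s : ℝ}
    (hs : s ∈ Ioo 0 R)
    (hbd : ∀ p : ℝ × ℝ, p.1 ^ 2 + p.2 ^ 2 = R ^ 2 → L (s, 0) < L p)
    (hdec : ∀ p : ℝ × ℝ, p.1 ^ 2 + p.2 ^ 2 ≤ R ^ 2 → L p = L (s, 0) → fderiv ℝ L p (Y p) < 0)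
    (hLmono : StrictMonoOn (fun ρ => L (ρ, 0)) (Icc 0 R))
    {R' : ℝ} (hR' : 0 < R')
    (hinc : ∀ p : ℝ × ℝ, p.1 ^ 2 + p.2 ^ 2 ≤ R' ^ 2 → 0 ≤ fderiv ℝ V p (Y p))
    (hVmono : StrictMonoOn (fun ρ => V (ρ, 0)) (Icc 0 R')) :
    HasPeriodicOrbitIn Y {p | p.1 ^ 2 + p.2 ^ 2 ≤ R ^ 2} := by
  have hpi : 0 < 2 * Real.pi := by positivity
  -- The right-hand side of the equation for `log ρ`, cut off at `ρ = R`.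
  set F : ℝ → ℝ → ℝ := fun θ ρ => A θ ρ / W θ ρ with hF
  set G : ℝ → ℝ → ℝ := fun θ σ => F θ (min (Real.exp σ) R) with hG
  have hmem : ∀ σ : ℝ, min (Real.exp σ) R ∈ Icc 0 R := fun σ =>
    ⟨le_min (Real.exp_pos σ).le hR.le, min_le_right _ _⟩
  have hFC : ContDiffOn ℝ 1 (Function.uncurry F) (Icc 0 (2 * Real.pi) ×ˢ Icc 0 R) :=
    hA.contDiffOn.div hW.contDiffOn fun x hx => (hWpos x.1 x.2 hx.2).ne'
  have hcpt : IsCompact (Icc 0 (2 * Real.pi) ×ˢ Icc 0 R) := isCompact_Icc.prod isCompact_Icc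
  obtain ⟨K, hK⟩ := hFC.exists_lipschitzOnWith one_ne_zero
    ((convex_Icc _ _).prod (convex_Icc _ _)) hcpt
  obtain ⟨M, hM⟩ := hcpt.exists_bound_of_continuousOn hFC.continuousOn
  have hGM : ∀ θ ∈ Icc 0 (2 * Real.pi), ∀ σ, ‖G θ σ‖ ≤ M.toNNReal := fun θ hθ σ =>
    (hM (θ, min (Real.exp σ) R) ⟨hθ, hmem σ⟩).trans (Real.le_coe_toNNReal M)
  set N : ℝ := M.toNNReal * (2 * Real.pi) with hN
  have hN0 : 0 ≤ N := by positivity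
  -- Starting values on the level curve and near the origin.
  set σ₂ := Real.log s with hσ₂
  have hexp₂ : Real.exp σ₂ = s := Real.exp_log hs.1
  obtain ⟨σ₁, hσ₁, hσ₁R⟩ : ∃ σ₁ ≤ σ₂, Real.exp (σ₁ + N) ≤ min R R' := by
    refine ⟨min σ₂ (Real.log (min R R') - N), min_le_left _ _, ?_⟩
    rw [← Real.le_log_iff_exp_le (lt_min hR hR')]
    linarith [min_le_right σ₂ (Real.log (min R R') - N)]
  set r : NNReal := ⟨σ₂ - σ₁, sub_nonneg.2 hσ₁⟩ with hr
  set a : NNReal := r + M.toNNReal * ⟨2 * Real.pi, hpi.le⟩ with ha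
  obtain ⟨K', hK'⟩ : ∃ K', LipschitzOnWith K' Real.exp (Metric.closedBall σ₂ a) :=
    Real.contDiff_exp.contDiffOn.exists_lipschitzOnWith (one_ne_zero) (convex_closedBall _ _)
      (isCompact_closedBall _ _)
  have hpl : IsPicardLindelof G (tmin := 0) (tmax := 2 * Real.pi)
      ⟨0, left_mem_Icc.2 hpi.le⟩ σ₂ a r M.toNNReal (K * (1 * K')) :=
    { lipschitzOnWith := by
        intro θ hθ
        have h1 : LipschitzOnWith (1 * K') (fun σ => (θ, min (Real.exp σ) R))
            (Metric.closedBall σ₂ a) := by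
          have h2 : LipschitzWith 1 (fun x : ℝ => (θ, min x R)) :=
            ((LipschitzWith.prodMk_left θ).comp (LipschitzWith.id.min_const R)).weaken
              (one_mul (1 : NNReal)).le
          exact h2.comp_lipschitzOnWith hK'
        exact hK.comp h1 fun σ _ => ⟨hθ, hmem σ⟩
      continuousOn := fun σ _ => hFC.continuousOn.comp
        (continuousOn_id.prodMk continuousOn_const) fun θ hθ => ⟨hθ, hmem σ⟩
      norm_le := fun θ hθ σ _ => hGM θ hθ σ
      mul_max_le := by
        simp [ha, hpi.le]
        rfl }
  obtain ⟨α, hα, hαc⟩ := hpl.exists_forall_mem_closedBall_eq_hasDerivWithinAt_continuousOn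
  simp only at hα
  have hball : ∀ σ ∈ Icc σ₁ σ₂, σ ∈ Metric.closedBall σ₂ r := by
    intro σ hσ
    rw [Real.closedBall_eq_Icc]
    have : (r : ℝ) = σ₂ - σ₁ := rfl
    rw [this]
    exact ⟨by linarith [hσ.1], by linarith [hσ.2]⟩
  have h0mem : (0 : ℝ) ∈ Icc 0 (2 * Real.pi) := left_mem_Icc.2 hpi.le
  have h2mem : 2 * Real.pi ∈ Icc 0 (2 * Real.pi) := right_mem_Icc.2 hpi.le
  have hcα : ∀ σ ∈ Icc σ₁ σ₂, ContinuousOn (fun θ => α (σ, θ)) (Icc 0 (2 * Real.pi)) :=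
    fun σ hσ θ hθ => ((hα σ (hball σ hσ)).2 θ hθ).continuousWithinAt
  -- Where the cut-off is not active, the solutions give curves tangent to `Y`.
  have hcurve : ∀ σ ∈ Icc σ₁ σ₂, ∀ θ ∈ Icc 0 (2 * Real.pi), Real.exp (α (σ, θ)) ≤ R →
      HasDerivWithinAt (fun θ => clockwisePolar θ (Real.exp (α (σ, θ))))
        ((W θ (Real.exp (α (σ, θ))))⁻¹ • Y (clockwisePolar θ (Real.exp (α (σ, θ)))))
        (Icc 0 (2 * Real.pi)) θ := by
    intro σ hσ θ hθ hle
    refine hasDerivWithinAt_clockwisePolar (σ := fun θ => α (σ, θ)) hY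
      (hWpos θ _ ⟨(Real.exp_pos _).le, hle⟩).ne' ?_
    have := (hα σ (hball σ hσ)).2 θ hθ
    simpa only [hG, min_eq_left hle] using this
  have hp0 : ∀ ρ, clockwisePolar 0 ρ = (ρ, 0) := fun ρ => by simp [clockwisePolar]
  have hp2 : ∀ ρ, clockwisePolar (2 * Real.pi) ρ = (ρ, 0) := fun ρ => by simp [clockwisePolar]
  -- All these solutions stay inside the level curve.
  have htrap : ∀ σ ∈ Icc σ₁ σ₂, ∀ θ ∈ Icc 0 (2 * Real.pi), Real.exp (α (σ, θ)) ≤ R ∧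
      L (clockwisePolar θ (Real.exp (α (σ, θ)))) ≤ L (s, 0) := by
    intro σ hσ
    have hK₀ : ∀ θ, clockwisePolar θ (Real.exp (α (σ, θ))) ∈
        {p : ℝ × ℝ | p.1 ^ 2 + p.2 ^ 2 ≤ R ^ 2} ↔ Real.exp (α (σ, θ)) ≤ R := by
      intro θ
      rw [mem_ofPred, clockwisePolar_sq_add_sq]
      exact pow_le_pow_iff_left₀ (Real.exp_pos _).le hR.le two_ne_zero
    have hsq : Continuous fun p : ℝ × ℝ => p.1 ^ 2 + p.2 ^ 2 := by fun_prop
    have h := mem_sublevel_of_trapping (γ := fun θ => clockwisePolar θ (Real.exp (α (σ, θ))))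
      (L := L) (K := {p | p.1 ^ 2 + p.2 ^ 2 ≤ R ^ 2}) (c := L (s, 0)) (a := 0) (b := 2 * Real.pi)
      (isClosed_le hsq continuous_const) hL.continuous ?_ ?_ ?_ ?_
    · exact fun θ hθ => ⟨(hK₀ θ).1 (h θ hθ).1, (h θ hθ).2⟩
    · have hc := Real.continuous_exp.comp_continuousOn (hcα σ hσ)
      exact (hc.mul Real.continuous_cos.continuousOn).prodMk
        (hc.mul Real.continuous_sin.continuousOn).neg
    · intro p hp hpc
      have hne : p.1 ^ 2 + p.2 ^ 2 ≠ R ^ 2 := fun h => (hbd p h).not_ge hpc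
      filter_upwards [hsq.continuousAt.eventually_lt_const (lt_of_le_of_ne hp hne)] with x hx
        using le_of_lt hx
    · rw [hK₀, (hα σ (hball σ hσ)).1, hp0]
      have hle : Real.exp σ ≤ s := hexp₂ ▸ Real.exp_le_exp.2 hσ.2
      have hleR := hle.trans hs.2.le
      exact ⟨hleR, hLmono.monotoneOn ⟨(Real.exp_pos _).le, hleR⟩ (Ioo_subset_Icc_self hs) hle⟩
    · intro θ hθ hθK hθL
      have hle := (hK₀ θ).1 hθK
      have hW' := hWpos θ _ ⟨(Real.exp_pos (α (σ, θ))).le, hle⟩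
      refine ⟨_, ?_, (hL _).hasFDerivAt.comp_hasDerivWithinAt θ
        ((hcurve σ hσ θ (Ico_subset_Icc_self hθ) hle).mono_of_mem_nhdsWithin
          (Icc_mem_nhdsGE_of_mem hθ))⟩
      rw [map_smul, smul_eq_mul]
      exact mul_neg_of_pos_of_neg (inv_pos.2 hW') (hdec _ hθK hθL)
  have hret₂ : α (σ₂, 2 * Real.pi) ≤ σ₂ := by
    have h := htrap σ₂ (right_mem_Icc.2 hσ₁) _ h2mem
    rw [hp2] at h
    have := (hLmono.le_iff_le ⟨(Real.exp_pos _).le, h.1⟩ (Ioo_subset_Icc_self hs)).1 h.2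
    rwa [← hexp₂, Real.exp_le_exp] at this
  have hret₁ : σ₁ ≤ α (σ₁, 2 * Real.pi) := by
    have hmem₁ := left_mem_Icc.2 hσ₁
    have hsmall : ∀ θ ∈ Icc 0 (2 * Real.pi), Real.exp (α (σ₁, θ)) ≤ min R R' := by
      intro θ hθ
      refine le_trans (Real.exp_le_exp.2 ?_) hσ₁R
      have h1 := (convex_Icc 0 (2 * Real.pi)).norm_image_sub_le_of_norm_hasDerivWithin_le
        (f := fun θ => α (σ₁, θ)) (hα σ₁ (hball _ hmem₁)).2 (fun θ hθ => hGM θ hθ _) h0mem hθ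
      rw [(hα σ₁ (hball _ hmem₁)).1, sub_zero, Real.norm_of_nonneg hθ.1, Real.norm_eq_abs] at h1
      have h2 : (M.toNNReal : ℝ) * θ ≤ N := mul_le_mul_of_nonneg_left hθ.2 M.toNNReal.2
      linarith [le_abs_self (α (σ₁, θ) - σ₁)]
    have hmono : MonotoneOn (fun θ => V (clockwisePolar θ (Real.exp (α (σ₁, θ)))))
        (Icc 0 (2 * Real.pi)) := by
      have hd : ∀ θ ∈ Icc 0 (2 * Real.pi), _ := fun θ hθ =>
        (hV _).hasFDerivAt.comp_hasDerivWithinAt θ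
          (hcurve σ₁ hmem₁ θ hθ ((hsmall θ hθ).trans (min_le_left _ _)))
      refine monotoneOn_of_hasDerivWithinAt_nonneg (convex_Icc _ _)
        (fun θ hθ => (hd θ hθ).continuousWithinAt)
        (fun θ hθ => (hd θ (interior_subset hθ)).mono interior_subset) fun θ hθ => ?_
      have hθ' := interior_subset hθ
      rw [map_smul, smul_eq_mul]
      refine mul_nonneg (inv_nonneg.2 (hWpos θ _ ⟨(Real.exp_pos _).le,
        (hsmall θ hθ').trans (min_le_left _ _)⟩).le) (hinc _ ?_)
      rw [clockwisePolar_sq_add_sq]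
      exact pow_le_pow_left₀ (Real.exp_pos _).le ((hsmall θ hθ').trans (min_le_right _ _)) 2
    have h1 := hmono h0mem h2mem hpi.le
    simp only [hp0, hp2] at h1
    have h2 := (hVmono.le_iff_le ⟨(Real.exp_pos _).le, (hsmall 0 h0mem).trans (min_le_right _ _)⟩
      ⟨(Real.exp_pos _).le, (hsmall _ h2mem).trans (min_le_right _ _)⟩).1 h1
    rwa [Real.exp_le_exp, (hα σ₁ (hball _ hmem₁)).1] at h2
  obtain ⟨σ, hσ, hfix⟩ : ∃ σ ∈ Icc σ₁ σ₂, α (σ, 2 * Real.pi) = σ := by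
    have hc : ContinuousOn (fun σ => α (σ, 2 * Real.pi) - σ) (Icc σ₁ σ₂) :=
      (hαc.comp (continuousOn_id.prodMk continuousOn_const)
        fun σ hσ => ⟨hball σ hσ, h2mem⟩).sub continuousOn_id
    obtain ⟨σ, hσ, h⟩ := intermediate_value_Icc' hσ₁ hc ⟨sub_nonpos.2 hret₂, sub_nonneg.2 hret₁⟩
    exact ⟨σ, hσ, sub_eq_zero.1 h⟩
  obtain ⟨g, hgper, hgd, hgeq⟩ := exists_periodic_of_hasDerivWithinAt_Icc (G := G) hpi
    (fun θ σ => by simp only [hG, hF, hAper, hWper])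
    (f := fun θ => α (σ, θ)) (hα σ (hball σ hσ)).2 (by rw [(hα σ (hball σ hσ)).1, hfix])
  have hgR : ∀ θ, Real.exp (g θ) ≤ R := by
    intro θ
    obtain ⟨θ', hθ', h⟩ := hgper.exists_mem_Ico₀ hpi θ
    rw [h, hgeq (Ico_subset_Icc_self hθ')]
    exact (htrap σ hσ θ' (Ico_subset_Icc_self hθ')).1
  have hgcont : Continuous g := continuous_iff_continuousAt.2 fun θ => (hgd θ).continuousAt
  refine HasPeriodicOrbitIn.of_time_change (p := fun θ => clockwisePolar θ (Real.exp (g θ)))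
    (l := fun θ => (W θ (Real.exp (g θ)))⁻¹) hpi ?_ ?_ ?_ ?_ ?_ ⟨Real.pi, ?_⟩ ?_
  · intro θ
    simp only [clockwisePolar, Real.cos_add_two_pi, Real.sin_add_two_pi, hgper θ]
  · intro θ
    simp only [hWper, hgper θ]
  · exact (hW.continuous.comp (continuous_id.prodMk (Real.continuous_exp.comp hgcont))).inv₀
      fun θ => (hWpos θ _ ⟨(Real.exp_pos _).le, hgR θ⟩).ne'
  · exact fun θ => inv_pos.2 (hWpos θ _ ⟨(Real.exp_pos _).le, hgR θ⟩)
  · intro θ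
    rw [← hasDerivWithinAt_univ]
    refine hasDerivWithinAt_clockwisePolar hY (hWpos θ _ ⟨(Real.exp_pos _).le, hgR θ⟩).ne' ?_
    have := hgd θ
    simp only [hG, min_eq_left (hgR θ)] at this
    exact this.hasDerivWithinAt
  · intro h
    have h1 := congrArg Prod.fst h
    simp only [clockwisePolar, Real.cos_pi, Real.cos_zero] at h1
    linarith [Real.exp_pos (g Real.pi), Real.exp_pos (g 0)]
  · intro θ
    rw [mem_ofPred, clockwisePolar_sq_add_sq]
    exact pow_le_pow_left₀ (Real.exp_pos _).le (hgR θ) 2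

/-! ### Liénard systems with a quadratic fast nullcline -/

/-- The vector field of the Liénard system `ε u' = v + u² + m u`, `v' = -u g(u)`. -/
noncomputable def lienardField (ε m : ℝ) (g : ℝ → ℝ) (p : ℝ × ℝ) : ℝ × ℝ :=
  ((p.2 + p.1 ^ 2 + m * p.1) / ε, -(p.1 * g p.1))

theorem mem_closedBall_zero_of_sq_add_sq_le {p : ℝ × ℝ} {R : ℝ} (hR : 0 ≤ R)
    (hp : p.1 ^ 2 + p.2 ^ 2 ≤ R ^ 2) : p ∈ Metric.closedBall 0 R := by
  rw [mem_closedBall_zero_iff, Prod.norm_def, max_le_iff, Real.norm_eq_abs, Real.norm_eq_abs]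
  exact ⟨abs_le_of_sq_le_sq (by nlinarith [sq_nonneg p.2]) hR,
    abs_le_of_sq_le_sq (by nlinarith [sq_nonneg p.1]) hR⟩

theorem exists_forall_sq_add_sq_le_of_eventually {P : ℝ × ℝ → Prop} (h : ∀ᶠ p in 𝓝 0, P p) :
    ∃ R > 0, ∀ p : ℝ × ℝ, p.1 ^ 2 + p.2 ^ 2 ≤ R ^ 2 → P p := by
  obtain ⟨R, hR, h⟩ := Metric.nhds_basis_closedBall.eventually_iff.1 h
  exact ⟨R, hR, fun p hp => h (mem_closedBall_zero_of_sq_add_sq_le hR.le hp)⟩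

/-- A quadratic form adapted to the linear part of the Liénard system with `g 0 = a`. -/
noncomputable def lienardQuadratic (ε a l : ℝ) (p : ℝ × ℝ) : ℝ :=
  a * ε / 2 * p.1 ^ 2 + 1 / 2 * p.2 ^ 2 + l * (p.1 * p.2)

theorem contDiff_lienardQuadratic (ε a l : ℝ) : ContDiff ℝ 1 (lienardQuadratic ε a l) := by
  unfold lienardQuadratic
  fun_prop

theorem fderiv_lienardQuadratic (ε a l : ℝ) (p x : ℝ × ℝ) :
    fderiv ℝ (lienardQuadratic ε a l) p x =
      (a * ε * p.1 + l * p.2) * x.1 + (p.2 + l * p.1) * x.2 := by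
  have hu := hasFDerivAt_fst (𝕜 := ℝ) (p := p)
  have hv := hasFDerivAt_snd (𝕜 := ℝ) (p := p)
  have h := (((hu.pow 2).const_mul (a * ε / 2)).add ((hv.pow 2).const_mul (1 / 2))).add
    ((hu.mul hv).const_mul l)
  have h' : HasFDerivAt (lienardQuadratic ε a l) _ p := h
  rw [h'.fderiv]
  simp
  ring

/-- The cross term, proportional to the trace parameter `m`, makes the derivative along the field
definite with the sign of `m`: the origin is attracting for `m < 0` and repelling for `m > 0`. -/
theorem exists_lienardQuadratic_bounds {ε a m : ℝ} (hε : 0 < ε) (ha : 0 < a) (hm : m ≠ 0)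
    {g : ℝ → ℝ} (hg : Continuous g) (hg0 : g 0 = a) :
    ∃ l, ∃ k > 0, ∃ R > 0, ∀ p : ℝ × ℝ, p.1 ^ 2 + p.2 ^ 2 ≤ R ^ 2 →
      k * (p.1 ^ 2 + p.2 ^ 2) ≤ lienardQuadratic ε a l p ∧
      k * (p.1 ^ 2 + p.2 ^ 2) ≤
        m * fderiv ℝ (lienardQuadratic ε a l) p (lienardField ε m g p) := by
  have hm2 : 0 < m ^ 2 := by positivity
  -- The cross term is taken small enough to keep both quadratic forms definite.
  obtain ⟨κ, hκ, hκ1, hκ2⟩ : ∃ κ : ℝ, 0 < κ ∧ κ ≤ 1 / 2 ∧ κ * m ^ 2 ≤ a * ε / 4 := by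
    refine ⟨min (1 / 2) (a * ε / (4 * m ^ 2)), by positivity, min_le_left _ _, ?_⟩
    refine (mul_le_mul_of_nonneg_right (min_le_right _ _) hm2.le).trans_eq ?_
    field_simp
  -- The error terms beyond the linear part have small coefficients near the origin.
  set e₁ : ℝ × ℝ → ℝ := fun p =>
    m * ((a * ε * p.1 + κ * m * p.2) / ε - κ * m * (g p.1 - a)) with he₁
  set e₂ : ℝ × ℝ → ℝ := fun p => -(m * (g p.1 - a)) with he₂
  set k₀ : ℝ := min (m ^ 2 * (a / 4)) (m ^ 2 * (κ / (2 * ε))) with hk₀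
  have hk₀pos : 0 < k₀ := by positivity
  have hc₁ : Continuous e₁ := by fun_prop
  have hc₂ : Continuous e₂ := by fun_prop
  have h₁ : ∀ᶠ p in 𝓝 (0 : ℝ × ℝ), |e₁ p| < k₀ / 4 :=
    hc₁.abs.continuousAt.eventually_lt_const (by simp [he₁, hg0]; positivity)
  have h₂ : ∀ᶠ p in 𝓝 (0 : ℝ × ℝ), |e₂ p| < k₀ / 4 :=
    hc₂.abs.continuousAt.eventually_lt_const (by simp [he₂, hg0]; positivity)
  obtain ⟨R, hR, h⟩ := exists_forall_sq_add_sq_le_of_eventually (h₁.and h₂)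
  refine ⟨κ * m, min (min (a * ε / 4) (1 / 4)) (k₀ / 4), by positivity, R, hR, fun p hp => ?_⟩
  obtain ⟨h₁, h₂⟩ := h p hp
  obtain ⟨u, v⟩ := p
  constructor
  · refine (mul_le_mul_of_nonneg_right (min_le_left _ _) (by positivity)).trans ?_
    have h3 := mul_le_mul_of_nonneg_right (min_le_left (a * ε / 4) (1 / 4)) (sq_nonneg u)
    have h4 := mul_le_mul_of_nonneg_right (min_le_right (a * ε / 4) (1 / 4)) (sq_nonneg v)
    have h5 : κ * (κ * m ^ 2) ≤ 1 / 2 * (a * ε / 4) :=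
      mul_le_mul hκ1 hκ2 (by positivity) (by norm_num)
    have h6 := mul_le_mul_of_nonneg_right h5 (sq_nonneg u)
    simp only [lienardQuadratic]
    nlinarith [sq_nonneg (2 * κ * m * u + v)]
  · have hident : m * fderiv ℝ (lienardQuadratic ε a (κ * m)) (u, v) (lienardField ε m g (u, v)) =
        m ^ 2 * (a * (1 - κ) * u ^ 2 + κ / ε * v ^ 2 + κ * m / ε * (u * v)) +
          (e₁ (u, v) * u ^ 2 + e₂ (u, v) * (u * v)) := by
      rw [fderiv_lienardQuadratic]
      simp only [lienardField, he₁, he₂]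
      field_simp
      ring
    rw [hident]
    have hmain : m ^ 2 * (a / 4) * u ^ 2 + m ^ 2 * (κ / (2 * ε)) * v ^ 2 ≤
        m ^ 2 * (a * (1 - κ) * u ^ 2 + κ / ε * v ^ 2 + κ * m / ε * (u * v)) := by
      have h3 : κ * m ^ 2 / ε ≤ a / 4 := by
        rw [div_le_iff₀ hε]
        linarith
      have h4 : 0 ≤ κ / (2 * ε) * (v + m * u) ^ 2 := by positivity
      have h5 : a / 4 * u ^ 2 + κ / (2 * ε) * v ^ 2 ≤
          a * (1 - κ) * u ^ 2 + κ / ε * v ^ 2 + κ * m / ε * (u * v) := by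
        have e : a * (1 - κ) * u ^ 2 + κ / ε * v ^ 2 + κ * m / ε * (u * v) =
            κ / (2 * ε) * (v + m * u) ^ 2 + κ / (2 * ε) * v ^ 2 +
              (a * (1 - κ) - κ * m ^ 2 / ε / 2) * u ^ 2 := by
          field_simp
          ring
        have h6 : a / 4 ≤ a * (1 - κ) - κ * m ^ 2 / ε / 2 := by nlinarith
        nlinarith [mul_le_mul_of_nonneg_right h6 (sq_nonneg u)]
      calc _ = m ^ 2 * (a / 4 * u ^ 2 + κ / (2 * ε) * v ^ 2) := by ring
        _ ≤ _ := mul_le_mul_of_nonneg_left h5 hm2.le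
    have h3 := mul_le_mul_of_nonneg_right
      (min_le_left (m ^ 2 * (a / 4)) (m ^ 2 * (κ / (2 * ε)))) (sq_nonneg u)
    have h4 := mul_le_mul_of_nonneg_right
      (min_le_right (m ^ 2 * (a / 4)) (m ^ 2 * (κ / (2 * ε)))) (sq_nonneg v)
    have h5 := mul_le_mul_of_nonneg_right
      (min_le_right (min (a * ε / 4) (1 / 4)) (k₀ / 4)) (add_nonneg (sq_nonneg u) (sq_nonneg v))
    have h6 : -(k₀ / 4 * u ^ 2) ≤ e₁ (u, v) * u ^ 2 := by
      nlinarith [neg_abs_le (e₁ (u, v)), sq_nonneg u]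
    have h7 : -(k₀ / 4 * ((u ^ 2 + v ^ 2) / 2)) ≤ e₂ (u, v) * (u * v) := by
      have h8 : |u * v| ≤ (u ^ 2 + v ^ 2) / 2 := by
        rw [abs_le]
        constructor <;> nlinarith [sq_nonneg (u + v), sq_nonneg (u - v)]
      have h9 : |e₂ (u, v) * (u * v)| ≤ k₀ / 4 * ((u ^ 2 + v ^ 2) / 2) := by
        rw [abs_mul]
        exact mul_le_mul h₂.le h8 (abs_nonneg _) (by positivity)
      linarith [neg_abs_le (e₂ (u, v) * (u * v))]
    simp only at h5 ⊢
    linarith [mul_nonneg hk₀pos.le (sq_nonneg u), mul_nonneg hk₀pos.le (sq_nonneg v)]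

/-- A Lyapunov function, of degree four, for the Liénard system with `m = 0` and
`g u = a + b u + c u² + O(u³)`. The quadratic part is the energy of the linearization; the other
terms remove from its derivative along the field everything of order at most four except for a
negative definite quartic form, which exists because `b > 0`. -/
noncomputable def lienardQuartic (ε a b c : ℝ) (p : ℝ × ℝ) : ℝ :=
  ε * a / 2 * p.1 ^ 2 + ε * b / 3 * p.1 ^ 3 + 1 / 2 * p.2 ^ 2 + p.2 * p.1 ^ 2 +
    2 / (3 * a * ε) * p.2 ^ 3 + ε / 4 * (c - 2 / ε) * p.1 ^ 4 + b / (3 * a) * (p.1 ^ 3 * p.2) -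
    b / (6 * a ^ 2 * ε) * (p.1 * p.2 ^ 3)

theorem contDiff_lienardQuartic (ε a b c : ℝ) : ContDiff ℝ 1 (lienardQuartic ε a b c) := by
  unfold lienardQuartic
  fun_prop

theorem fderiv_lienardQuartic (ε a b c : ℝ) (p x : ℝ × ℝ) :
    fderiv ℝ (lienardQuartic ε a b c) p x =
      (ε * a * p.1 + ε * b * p.1 ^ 2 + 2 * (p.1 * p.2) + ε * (c - 2 / ε) * p.1 ^ 3 +
        b / a * (p.1 ^ 2 * p.2) - b / (6 * a ^ 2 * ε) * p.2 ^ 3) * x.1 +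
      (p.2 + p.1 ^ 2 + 2 / (a * ε) * p.2 ^ 2 + b / (3 * a) * p.1 ^ 3 -
        b / (2 * a ^ 2 * ε) * (p.1 * p.2 ^ 2)) * x.2 := by
  have hu := hasFDerivAt_fst (𝕜 := ℝ) (p := p)
  have hv := hasFDerivAt_snd (𝕜 := ℝ) (p := p)
  have h := (((((((hu.pow 2).const_mul (ε * a / 2)).add ((hu.pow 3).const_mul (ε * b / 3))).add
    ((hv.pow 2).const_mul (1 / 2))).add (hv.mul (hu.pow 2))).add
    ((hv.pow 3).const_mul (2 / (3 * a * ε)))).add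
    ((hu.pow 4).const_mul (ε / 4 * (c - 2 / ε)))).add
    (((hu.pow 3).mul hv).const_mul (b / (3 * a))) |>.sub
    ((hu.mul (hv.pow 3)).const_mul (b / (6 * a ^ 2 * ε)))
  have h' : HasFDerivAt (lienardQuartic ε a b c) _ p := h
  rw [h'.fderiv]
  simp
  ring

theorem exists_lienardQuartic_bounds {ε a b c : ℝ} (hε : 0 < ε) (ha : 0 < a) (hb : 0 < b)
    {g h : ℝ → ℝ} (hh : Continuous h) (hg : ∀ u, g u = a + b * u + c * u ^ 2 + h u * u ^ 3) :
    ∃ R > 0, (∀ p : ℝ × ℝ, p.1 ^ 2 + p.2 ^ 2 ≤ R ^ 2 → p ≠ 0 →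
      0 < lienardQuartic ε a b c p ∧
      fderiv ℝ (lienardQuartic ε a b c) p (lienardField ε 0 g p) < 0) ∧
      StrictMonoOn (fun u => lienardQuartic ε a b c (u, 0)) (Icc 0 R) := by
  -- The terms of higher order in `L` are `e₁ u² + e₂ v²`, those in its derivative along the field
  -- are `e₃ u⁴ + e₄ u² v²`, and `e₅ u` is the higher order part of the derivative of `L` along the
  -- horizontal axis. Each error in the derivative contains a factor `u²`, so that none multiplies
  -- `v⁴`.
  set e₁ : ℝ × ℝ → ℝ := fun p => ε * b / 3 * p.1 + p.2 + ε / 4 * (c - 2 / ε) * p.1 ^ 2 +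
    b / (3 * a) * (p.1 * p.2) with he₁
  set e₂ : ℝ × ℝ → ℝ := fun p => 2 / (3 * a * ε) * p.2 - b / (6 * a ^ 2 * ε) * (p.1 * p.2) with he₂
  set e₃ : ℝ × ℝ → ℝ := fun p => -(h p.1 * p.2) - (c + h p.1 * p.1) * p.1 +
    (c - 2 / ε) * p.1 + b / (a * ε) * p.2 - b ^ 2 / (3 * a) * p.1 -
    b / (3 * a) * (c + h p.1 * p.1) * p.1 ^ 2 with he₃
  set e₄ : ℝ × ℝ → ℝ := fun p => -(2 / (a * ε) * (c + h p.1 * p.1) * p.1) -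
    b / (6 * a ^ 2 * ε ^ 2) * p.2 +
    b / (2 * a ^ 2 * ε) * (b * p.1 + (c + h p.1 * p.1) * p.1 ^ 2) with he₄
  set e₅ : ℝ × ℝ → ℝ := fun p => ε * b * p.1 + ε * (c - 2 / ε) * p.1 ^ 2 with he₅
  have h₁ : ∀ᶠ p in 𝓝 (0 : ℝ × ℝ), |e₁ p| < ε * a / 4 := by
    have : Continuous e₁ := by fun_prop
    exact this.abs.continuousAt.eventually_lt_const (by simp [he₁]; positivity)
  have h₂ : ∀ᶠ p in 𝓝 (0 : ℝ × ℝ), |e₂ p| < 1 / 4 := by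
    have : Continuous e₂ := by fun_prop
    exact this.abs.continuousAt.eventually_lt_const (by simp [he₂])
  have h₃ : ∀ᶠ p in 𝓝 (0 : ℝ × ℝ), |e₃ p| < b / 6 := by
    have : Continuous e₃ := by fun_prop
    exact this.abs.continuousAt.eventually_lt_const (by simp [he₃]; positivity)
  have h₄ : ∀ᶠ p in 𝓝 (0 : ℝ × ℝ), |e₄ p| < b / (4 * a * ε) := by
    have : Continuous e₄ := by fun_prop
    exact this.abs.continuousAt.eventually_lt_const (by simp [he₄]; positivity)
  have h₅ : ∀ᶠ p in 𝓝 (0 : ℝ × ℝ), |e₅ p| < ε * a / 2 := by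
    have : Continuous e₅ := by fun_prop
    exact this.abs.continuousAt.eventually_lt_const (by simp [he₅]; positivity)
  obtain ⟨R, hR, hall⟩ :=
    exists_forall_sq_add_sq_le_of_eventually (h₁.and (h₂.and (h₃.and (h₄.and h₅))))
  refine ⟨R, hR, fun p hp hp0 => ?_, ?_⟩
  · obtain ⟨h₁, h₂, h₃, h₄, -⟩ := hall p hp
    obtain ⟨u, v⟩ := p
    have hpos : 0 < u ^ 2 ∨ 0 < v ^ 2 := by
      by_contra! hcon
      exact hp0 (Prod.ext (pow_eq_zero_iff two_ne_zero |>.1 (le_antisymm hcon.1 (sq_nonneg u)))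
        (pow_eq_zero_iff two_ne_zero |>.1 (le_antisymm hcon.2 (sq_nonneg v))))
    constructor
    · have hident : lienardQuartic ε a b c (u, v) =
          (ε * a / 2 + e₁ (u, v)) * u ^ 2 + (1 / 2 + e₂ (u, v)) * v ^ 2 := by
        simp only [lienardQuartic, he₁, he₂]
        ring
      have h3 : 0 < ε * a / 2 + e₁ (u, v) := by linarith [neg_abs_le (e₁ (u, v)), mul_pos hε ha]
      have h4 : 0 < 1 / 2 + e₂ (u, v) := by linarith [neg_abs_le (e₂ (u, v))]
      rw [hident]
      rcases hpos with h | h <;> positivity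
    · have hident : fderiv ℝ (lienardQuartic ε a b c) (u, v) (lienardField ε 0 g (u, v)) =
          -((b / 3 - e₃ (u, v)) * (u ^ 2) ^ 2 + (b / (2 * a * ε) - e₄ (u, v)) * (u ^ 2 * v ^ 2) +
            b / (6 * a ^ 2 * ε ^ 2) * (v ^ 2) ^ 2) := by
        rw [fderiv_lienardQuartic]
        simp only [lienardField, he₃, he₄, hg]
        field_simp
        ring
      have h3 : 0 < b / 3 - e₃ (u, v) := by linarith [le_abs_self (e₃ (u, v))]
      have h4 : 0 < b / (2 * a * ε) - e₄ (u, v) := by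
        have : b / (2 * a * ε) = 2 * (b / (4 * a * ε)) := by
          field_simp
          ring
        have h5 : 0 < b / (4 * a * ε) := by positivity
        linarith [le_abs_self (e₄ (u, v))]
      rw [hident, neg_lt_zero]
      rcases hpos with h | h <;> positivity
  · refine strictMonoOn_of_hasDerivWithinAt_pos (convex_Icc 0 R)
      (f' := fun u => u * (ε * a + e₅ (u, 0))) ?_ ?_ ?_
    · exact ((contDiff_lienardQuartic ε a b c).continuous.comp
        (continuous_id.prodMk continuous_const)).continuousOn
    · intro u hu
      have h1 := ((contDiff_lienardQuartic ε a b c).differentiable one_ne_zero (u, 0)).hasFDerivAt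
      have h2 := h1.comp_hasDerivAt u ((hasDerivAt_id u).prodMk (hasDerivAt_const u (0 : ℝ)))
      refine (h2.congr_deriv ?_).hasDerivWithinAt
      rw [fderiv_lienardQuartic]
      simp only [he₅]
      ring
    · intro u hu
      rw [interior_Icc] at hu
      obtain ⟨-, -, -, -, h₅⟩ := hall (u, 0) (by nlinarith [hu.1, hu.2])
      have : 0 < ε * a + e₅ (u, 0) := by linarith [neg_abs_le (e₅ (u, 0)), mul_pos hε ha]
      exact mul_pos hu.1 this

/-- The linear part of the Liénard field turns clockwise, so the whole field does so near the
origin, uniformly in the parameter. -/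
theorem eventually_forall_lienard_rotation_pos {ε : ℝ} (hε : 0 < ε) {g : ℝ → ℝ → ℝ}
    (hg : Continuous (Function.uncurry g)) (hg0 : 0 < g 0 0) :
    ∀ᶠ z in 𝓝 (0 : ℝ × ℝ), ∀ θ : ℝ, 0 < Real.sin θ ^ 2 / ε +
      Real.cos θ ^ 2 * g z.1 (z.2 * Real.cos θ) -
        Real.sin θ * Real.cos θ * (z.2 * Real.cos θ + z.1) / ε := by
  set W : (ℝ × ℝ) → ℝ → ℝ := fun z θ => Real.sin θ ^ 2 / ε +
      Real.cos θ ^ 2 * g z.1 (z.2 * Real.cos θ) -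
        Real.sin θ * Real.cos θ * (z.2 * Real.cos θ + z.1) / ε with hW
  have hcont : Continuous fun x : (ℝ × ℝ) × ℝ => W x.1 x.2 := by
    have : Continuous fun x : (ℝ × ℝ) × ℝ => g x.1.1 (x.1.2 * Real.cos x.2) :=
      hg.comp (by fun_prop : Continuous fun x : (ℝ × ℝ) × ℝ => (x.1.1, x.1.2 * Real.cos x.2))
    fun_prop
  have h := (isCompact_Icc (a := 0) (b := 2 * Real.pi)).eventually_forall_of_forall_eventually
    (x₀ := (0 : ℝ × ℝ)) (P := fun z θ => 0 < W z θ) (fun θ _ => by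
      refine hcont.continuousAt.eventually_const_lt ?_
      have h1 := Real.sin_sq_add_cos_sq θ
      simp only [hW, Prod.fst_zero, Prod.snd_zero, zero_mul, add_zero, mul_zero, zero_div, sub_zero]
      rcases (sq_nonneg (Real.sin θ)).eq_or_lt with h2 | h2
      · have h3 : Real.cos θ ^ 2 = 1 := by linarith
        rw [← h2, h3]
        simpa using hg0
      · have : 0 ≤ Real.cos θ ^ 2 * g 0 0 := by positivity
        have : 0 < Real.sin θ ^ 2 / ε := by positivity
        linarith)
  filter_upwards [h] with z hz θ
  have hper : Function.Periodic (W z) (2 * Real.pi) := fun θ => by simp [hW]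
  obtain ⟨θ', hθ', heq⟩ := hper.exists_mem_Ico₀ (by positivity) θ
  change 0 < W z θ
  rw [heq]
  exact hz θ' (Ico_subset_Icc_self hθ')

/-- Supercritical Hopf bifurcation of the Liénard system: when the coefficient `b` of `u` in `g`
is positive, there are small periodic orbits for all small positive values of `m`. -/
theorem eventually_hasPeriodicOrbitIn_lienard {ε a b c : ℝ} (hε : 0 < ε) (ha : 0 < a) (hb : 0 < b)
    {g : ℝ → ℝ → ℝ} (hg : ContDiff ℝ 1 (Function.uncurry g)) {h : ℝ → ℝ} (hh : Continuous h)
    (hg0 : ∀ u, g 0 u = a + b * u + c * u ^ 2 + h u * u ^ 3) {r : ℝ} (hr : 0 < r) :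
    ∀ᶠ m in 𝓝[>] 0, HasPeriodicOrbitIn (lienardField ε m (g m)) {p | p.1 ^ 2 + p.2 ^ 2 ≤ r ^ 2} := by
  have hg00 : g 0 0 = a := by simp [hg0]
  have hgm : ∀ m, ContDiff ℝ 1 (g m) := fun m => hg.comp (contDiff_const.prodMk contDiff_id)
  set L := lienardQuartic ε a b c with hL
  have hLC : ContDiff ℝ 1 L := contDiff_lienardQuartic ε a b c
  obtain ⟨R₀, hR₀, hLR, hLmono⟩ := exists_lienardQuartic_bounds hε ha hb hh hg0
  have hrot := eventually_forall_lienard_rotation_pos hε hg.continuous (hg00 ▸ ha)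
  obtain ⟨d, hd, hrot⟩ := Metric.nhds_basis_closedBall.eventually_iff.1 hrot
  set R := min (min R₀ r) d with hRdef
  have hR : 0 < R := lt_min (lt_min hR₀ hr) hd
  have hRR₀ : R ≤ R₀ := (min_le_left _ _).trans (min_le_left _ _)
  have hRr : R ≤ r := (min_le_left _ _).trans (min_le_right _ _)
  have hsqR : ∀ p : ℝ × ℝ, p.1 ^ 2 + p.2 ^ 2 ≤ R ^ 2 → p.1 ^ 2 + p.2 ^ 2 ≤ R₀ ^ 2 := fun p hp =>
    hp.trans (pow_le_pow_left₀ hR.le hRR₀ 2)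
  have hsq : Continuous fun p : ℝ × ℝ => p.1 ^ 2 + p.2 ^ 2 := by fun_prop
  have hdisc : IsCompact {p : ℝ × ℝ | p.1 ^ 2 + p.2 ^ 2 ≤ R ^ 2} :=
    (isCompact_closedBall (0 : ℝ × ℝ) R).of_isClosed_subset (isClosed_le hsq continuous_const)
      fun p hp => mem_closedBall_zero_of_sq_add_sq_le hR.le hp
  -- A level of `L` that is attained on the horizontal axis but not on the boundary of the disc.
  obtain ⟨s, hs, hbd⟩ : ∃ s ∈ Ioo 0 R, ∀ p : ℝ × ℝ, p.1 ^ 2 + p.2 ^ 2 = R ^ 2 → L (s, 0) < L p := by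
    have hcirc : IsCompact {p : ℝ × ℝ | p.1 ^ 2 + p.2 ^ 2 = R ^ 2} :=
      hdisc.of_isClosed_subset (isClosed_eq hsq continuous_const) fun p hp => le_of_eq hp
    have hne : {p : ℝ × ℝ | p.1 ^ 2 + p.2 ^ 2 = R ^ 2}.Nonempty := ⟨(R, 0), by simp⟩
    obtain ⟨p₀, hp₀, hmin⟩ := hcirc.exists_isMinOn hne hLC.continuous.continuousOn
    have hp₀' : p₀.1 ^ 2 + p₀.2 ^ 2 = R ^ 2 := hp₀
    have hpos : 0 < L p₀ := by
      refine (hLR p₀ (hsqR _ hp₀'.le) ?_).1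
      rintro rfl
      exact (pow_pos hR 2).ne (by simpa using hp₀')
    have hL0 : L (0, 0) = 0 := by simp [hL, lienardQuartic]
    have hc : ContinuousAt (fun u : ℝ => L (u, 0)) 0 :=
      (hLC.continuous.comp (continuous_id.prodMk continuous_const)).continuousAt
    have hev : ∀ᶠ u in 𝓝[>] (0 : ℝ), L (u, 0) < L p₀ :=
      (hc.eventually_lt_const (hL0.trans_lt hpos)).filter_mono nhdsWithin_le_nhds
    obtain ⟨s, hs1, hs2⟩ := (hev.and (Ioo_mem_nhdsGT hR)).exists
    exact ⟨s, hs2, fun p hp => hs1.trans_le (hmin hp)⟩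
  have hLs : 0 < L (s, 0) := (hLR (s, 0) (hsqR _ (by nlinarith [hs.1, hs.2]))
    (fun h => hs.1.ne' (congrArg Prod.fst h))).1
  -- On this level curve `L` still decreases when the parameter is perturbed.
  have hdec : ∀ᶠ m in 𝓝 (0 : ℝ), ∀ p ∈ {p : ℝ × ℝ | p.1 ^ 2 + p.2 ^ 2 ≤ R ^ 2} ∩ L ⁻¹' {L (s, 0)},
      fderiv ℝ L p (lienardField ε m (g m) p) < 0 := by
    refine (hdisc.inter_right (isClosed_singleton.preimage
      hLC.continuous)).eventually_forall_of_forall_eventually fun p hp => ?_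
    have hcont : Continuous fun x : ℝ × (ℝ × ℝ) =>
        fderiv ℝ L x.2 (lienardField ε x.1 (g x.1) x.2) := by
      refine ((hLC.continuous_fderiv one_ne_zero).comp continuous_snd).clm_apply ?_
      have : Continuous fun x : ℝ × (ℝ × ℝ) => g x.1 x.2.1 :=
        hg.continuous.comp (by fun_prop : Continuous fun x : ℝ × (ℝ × ℝ) => (x.1, x.2.1))
      unfold lienardField
      fun_prop
    refine hcont.continuousAt.eventually_lt_const (hLR p (hsqR _ hp.1) ?_).2
    rintro rfl
    have h1 : L (0, 0) = L (s, 0) := hp.2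
    have h2 : L (0, 0) = 0 := by simp [hL, lienardQuartic]
    linarith
  have hga : ∀ᶠ m in 𝓝 (0 : ℝ), 0 < g m 0 := by
    have : Continuous fun m => g m 0 :=
      hg.continuous.comp (by fun_prop : Continuous fun m : ℝ => (m, (0 : ℝ)))
    exact this.continuousAt.eventually_const_lt (ha.trans_eq hg00.symm)
  filter_upwards [hdec.filter_mono nhdsWithin_le_nhds, hga.filter_mono nhdsWithin_le_nhds,
    Ioc_mem_nhdsGT hd] with m hdec hga hm
  obtain ⟨l, k, hk, R', hR', hV⟩ := exists_lienardQuadratic_bounds hε hga hm.1.ne'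
    (hgm m).continuous rfl
  have hgpol : ContDiff ℝ 1 fun x : ℝ × ℝ => g m (x.2 * Real.cos x.1) :=
    (hgm m).comp (contDiff_snd.mul (Real.contDiff_cos.comp contDiff_fst))
  have hcos : ContDiff ℝ 1 fun x : ℝ × ℝ => Real.cos x.1 := Real.contDiff_cos.comp contDiff_fst
  have hsin : ContDiff ℝ 1 fun x : ℝ × ℝ => Real.sin x.1 := Real.contDiff_sin.comp contDiff_fst
  suffices hin : HasPeriodicOrbitIn (lienardField ε m (g m)) {p | p.1 ^ 2 + p.2 ^ 2 ≤ R ^ 2} by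
    obtain ⟨γ, T, hT, h1, h2, h3, h4⟩ := hin
    exact ⟨γ, T, hT, h1, h2, h3, fun t => (h4 t).trans (pow_le_pow_left₀ hR.le hRr 2)⟩
  refine hasPeriodicOrbitIn_of_clockwise
    (Y := lienardField ε m (g m))
    (A := fun θ ρ => Real.cos θ * (-Real.sin θ + ρ * Real.cos θ ^ 2 + m * Real.cos θ) / ε +
      Real.sin θ * Real.cos θ * g m (ρ * Real.cos θ))
    (W := fun θ ρ => Real.sin θ ^ 2 / ε + Real.cos θ ^ 2 * g m (ρ * Real.cos θ) -
        Real.sin θ * Real.cos θ * (ρ * Real.cos θ + m) / ε) (L := L)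
    (V := lienardQuadratic ε (g m 0) l) (s := s) hR
    ?_ ?_ ?_ ?_ ?_ ?_ (hLC.differentiable one_ne_zero)
    ((contDiff_lienardQuadratic ε (g m 0) l).differentiable one_ne_zero) hs hbd
    (fun p hp hpL => hdec p ⟨hp, hpL⟩) (hLmono.mono (Icc_subset_Icc_right hRR₀)) hR' ?_ ?_
  · exact ((hcos.mul ((hsin.neg.add (contDiff_snd.mul (hcos.pow 2))).add
      (contDiff_const.mul hcos))).div_const _).add ((hsin.mul hcos).mul hgpol)
  · exact (((hsin.pow 2).div_const _).add ((hcos.pow 2).mul hgpol)).sub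
      (((hsin.mul hcos).mul ((contDiff_snd.mul hcos).add contDiff_const)).div_const _)
  · intro θ ρ
    simp only [Real.cos_add_two_pi, Real.sin_add_two_pi]
  · intro θ ρ
    simp only [Real.cos_add_two_pi, Real.sin_add_two_pi]
  · intro θ ρ hρ
    refine hrot (x := (m, ρ)) ?_ θ
    rw [mem_closedBall_zero_iff, Prod.norm_def, max_le_iff, Real.norm_eq_abs, Real.norm_eq_abs,
      abs_of_pos hm.1, abs_of_nonneg hρ.1]
    exact ⟨hm.2, hρ.2.trans (min_le_right _ _)⟩
  · intro θ ρ
    have hsc := Real.sin_sq_add_cos_sq θ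
    have hs2 : Real.sin θ ^ 2 = 1 - Real.cos θ ^ 2 := by linarith
    simp only [lienardField, clockwisePolar]
    ext
    · simp only
      field_simp
      linear_combination ρ * (Real.sin θ - Real.cos θ ^ 2 * ρ - Real.cos θ * m) * hsc
    · simp only
      field_simp
      linear_combination ρ * Real.cos θ * ε * g m (ρ * Real.cos θ) * hsc
  · intro p hp
    have h1 := (hV p hp).2
    have h2 : 0 ≤ k * (p.1 ^ 2 + p.2 ^ 2) := by positivity
    exact nonneg_of_mul_nonneg_right (h2.trans h1) hm.1
  · intro u hu v hv huv
    have h1 : 0 < g m 0 * ε / 2 := by positivity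
    have h2 : u ^ 2 < v ^ 2 := pow_lt_pow_left₀ huv hu.1 two_ne_zero
    simp only [lienardQuadratic]
    nlinarith

/-! ### The rate as a function of the equilibrium -/

/-- The rate `∑ₙ xⁿ` (sum over `1 ≤ n ≤ N`) for which `x` is the first coordinate of the
equilibrium. -/
noncomputable def equilibriumRate (N : ℕ) (x : ℝ) : ℝ :=
  ∑ n ∈ Finset.Icc 1 N, x ^ n

/-- The derivative of `equilibriumRate`. -/
noncomputable def equilibriumRateDeriv (N : ℕ) (x : ℝ) : ℝ :=
  ∑ n ∈ Finset.Icc 1 N, (n : ℝ) * x ^ (n - 1)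

/-- The difference quotient of `equilibriumRate`, as a polynomial in both points. -/
noncomputable def equilibriumRateSlope (N : ℕ) (x y : ℝ) : ℝ :=
  ∑ n ∈ Finset.Icc 1 N, ∑ i ∈ Finset.range n, x ^ i * y ^ (n - 1 - i)

theorem equilibriumRateSlope_mul_sub (N : ℕ) (x y : ℝ) :
    equilibriumRateSlope N x y * (x - y) = equilibriumRate N x - equilibriumRate N y := by
  simp only [equilibriumRateSlope, equilibriumRate, Finset.sum_mul, ← Finset.sum_sub_distrib]
  refine Finset.sum_congr rfl fun n _ => ?_
  rw [← geom_sum₂_mul, Finset.sum_mul]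

theorem equilibriumRateSlope_self (N : ℕ) (x : ℝ) :
    equilibriumRateSlope N x x = equilibriumRateDeriv N x :=
  Finset.sum_congr rfl fun n _ => geom_sum₂_self x n

theorem contDiff_equilibriumRateSlope (N : ℕ) :
    ContDiff ℝ 1 fun p : ℝ × ℝ => equilibriumRateSlope N p.1 p.2 := by
  unfold equilibriumRateSlope
  fun_prop

theorem hasDerivAt_equilibriumRate (N : ℕ) (x : ℝ) :
    HasDerivAt (equilibriumRate N) (equilibriumRateDeriv N x) x := by
  unfold equilibriumRate equilibriumRateDeriv
  exact HasDerivAt.fun_sum fun n _ => hasDerivAt_pow n x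

theorem contDiff_equilibriumRate (N : ℕ) : ContDiff ℝ ∞ (equilibriumRate N) := by
  unfold equilibriumRate
  fun_prop

theorem contDiff_equilibriumRateDeriv (N : ℕ) : ContDiff ℝ ∞ (equilibriumRateDeriv N) := by
  unfold equilibriumRateDeriv
  fun_prop

/-- By induction on `k`: the two terms added in a step complete a square with the lower bound from
the previous step. -/
theorem mul_pow_le_equilibriumRateDeriv (k : ℕ) (x : ℝ) :
    (k + 1) * x ^ (2 * k) ≤ equilibriumRateDeriv (2 * k + 1) x := by
  induction k with
  | zero => simp [equilibriumRateDeriv]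
  | succ k ih =>
    have h1 : equilibriumRateDeriv (2 * (k + 1) + 1) x = equilibriumRateDeriv (2 * k + 1) x +
        (2 * k + 2) * x ^ (2 * k + 1) + (2 * k + 3) * x ^ (2 * k + 2) := by
      simp only [equilibriumRateDeriv]
      rw [show 2 * (k + 1) + 1 = 2 * k + 1 + 1 + 1 by ring, Finset.sum_Icc_succ_top (by omega),
        Finset.sum_Icc_succ_top (by omega)]
      push_cast
      ring
    have h2 : 0 ≤ (k + 1) * (x ^ k * (1 + x)) ^ 2 := by positivity
    rw [h1]
    push_cast
    have h3 : (k + 1) * (x ^ k * (1 + x)) ^ 2 =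
        (k + 1) * x ^ (2 * k) + 2 * (k + 1) * x ^ (2 * k + 1) + (k + 1) * x ^ (2 * k + 2) := by
      ring
    have h4 : x ^ (2 * (k + 1)) = x ^ (2 * k + 2) := by ring
    rw [h4]
    linarith

theorem equilibriumRateDeriv_pos {N : ℕ} (hN : Odd N) (x : ℝ) : 0 < equilibriumRateDeriv N x := by
  obtain ⟨k, rfl⟩ := hN
  rcases eq_or_ne x 0 with rfl | hx
  · rw [equilibriumRateDeriv, Finset.sum_eq_single 1]
    · simp
    · intro n hn h1
      have : n - 1 ≠ 0 := by
        have := (Finset.mem_Icc.1 hn).1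
        omega
      simp [this]
    · simp
  · have h1 : 0 < x ^ (2 * k) := by
      rw [pow_mul]
      positivity
    exact lt_of_lt_of_le (by positivity) (mul_pow_le_equilibriumRateDeriv k x)

theorem strictMono_equilibriumRate {N : ℕ} (hN : Odd N) : StrictMono (equilibriumRate N) :=
  strictMono_of_deriv_pos fun x => by
    rw [(hasDerivAt_equilibriumRate N x).deriv]
    exact equilibriumRateDeriv_pos hN x

/-- The rate is at least `x` to the right of `-1` and at most `x` to the left of it. -/
theorem mul_equilibriumRate_sub_nonneg (k : ℕ) (x : ℝ) :
    0 ≤ (1 + x) * (equilibriumRate (2 * k + 1) x - x) := by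
  induction k with
  | zero => simp [equilibriumRate]
  | succ k ih =>
    have h1 : equilibriumRate (2 * (k + 1) + 1) x = equilibriumRate (2 * k + 1) x +
        x ^ (2 * k + 2) + x ^ (2 * k + 3) := by
      simp only [equilibriumRate]
      rw [show 2 * (k + 1) + 1 = 2 * k + 1 + 1 + 1 by ring, Finset.sum_Icc_succ_top (by omega),
        Finset.sum_Icc_succ_top (by omega)]
    have h2 : 0 ≤ (x ^ (k + 1) * (1 + x)) ^ 2 := sq_nonneg _
    have h3 : (1 + x) * (equilibriumRate (2 * (k + 1) + 1) x - x) =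
        (1 + x) * (equilibriumRate (2 * k + 1) x - x) + (x ^ (k + 1) * (1 + x)) ^ 2 := by
      rw [h1]
      ring
    rw [h3]
    positivity

theorem surjective_equilibriumRate {N : ℕ} (hN : Odd N) :
    Function.Surjective (equilibriumRate N) := by
  obtain ⟨k, rfl⟩ := hN
  refine (contDiff_equilibriumRate _).continuous.surjective
    (tendsto_atTop_mono' _ ?_ tendsto_id) (tendsto_atBot_mono' _ ?_ tendsto_id)
  · filter_upwards [eventually_gt_atTop (-1)] with x hx
    have h1 := mul_equilibriumRate_sub_nonneg k x
    have := nonneg_of_mul_nonneg_right h1 (by linarith)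
    simpa using this
  · filter_upwards [eventually_lt_atBot (-1)] with x hx
    have h1 := mul_equilibriumRate_sub_nonneg k x
    by_contra! h2
    simp only [id] at h2
    nlinarith

/-- The first coordinate of the equilibrium is a smooth, strictly increasing function of the
rate. -/
theorem exists_inverse_equilibriumRate {N : ℕ} (hN : Odd N) :
    ∃ X : ℝ → ℝ, (∀ r, equilibriumRate N (X r) = r) ∧ (∀ x, X (equilibriumRate N x) = x) ∧
      StrictMono X ∧ ContDiff ℝ ∞ X ∧
      ∀ r, HasDerivAt X (equilibriumRateDeriv N (X r))⁻¹ r := by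
  set e := (strictMono_equilibriumRate hN).orderIsoOfSurjective _ (surjective_equilibriumRate hN)
  refine ⟨e.symm, e.apply_symm_apply, e.symm_apply_apply, e.symm.strictMono, ?_, fun r => ?_⟩
  · refine contDiff_iff_contDiffAt.2 fun r => ?_
    exact e.toHomeomorph.toOpenPartialHomeomorph.contDiffAt_symm_deriv
      (f₀' := equilibriumRateDeriv N (e.symm r)) (equilibriumRateDeriv_pos hN _).ne' (mem_univ _)
      (hasDerivAt_equilibriumRate N _) (contDiff_equilibriumRate N).contDiffAt
  · exact HasDerivAt.of_local_left_inverse e.symm.continuous.continuousAt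
      (hasDerivAt_equilibriumRate N _) (equilibriumRateDeriv_pos hN _).ne'
      (Eventually.of_forall e.apply_symm_apply)

/-- Expansion of the difference quotient to second order at `1 / 2`. -/
theorem exists_equilibriumRateSlope_expansion {N : ℕ} (hN : 2 ≤ N) :
    ∃ (a b c : ℝ) (h : ℝ → ℝ), 0 < a ∧ 0 < b ∧ Continuous h ∧
      ∀ u, equilibriumRateSlope N (1 / 2 + u) (1 / 2) = a + b * u + c * u ^ 2 + h u * u ^ 3 := by
  set P : Polynomial ℝ := ∑ n ∈ Finset.Icc 1 N, ∑ i ∈ Finset.range n,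
    (Polynomial.X + Polynomial.C (1 / 2)) ^ i * Polynomial.C ((1 / 2) ^ (n - 1 - i)) with hP
  have hcoeff : ∀ k < 2, 0 < P.coeff k := by
    intro k hk
    simp only [hP, Polynomial.finsetSum_coeff, Polynomial.coeff_mul_C, Polynomial.coeff_X_add_C_pow]
    refine Finset.sum_pos' (fun n _ => Finset.sum_nonneg fun i _ => by positivity)
      ⟨2, Finset.mem_Icc.2 ⟨by norm_num, hN⟩,
        Finset.sum_pos' (fun i _ => by positivity) ⟨1, by simp, ?_⟩⟩
    interval_cases k <;> norm_num
  refine ⟨P.coeff 0, P.coeff 1, P.coeff 2, fun u => P.divX.divX.divX.eval u, hcoeff 0 (by norm_num),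
    hcoeff 1 (by norm_num), Polynomial.continuous _, fun u => ?_⟩
  have heval : equilibriumRateSlope N (1 / 2 + u) (1 / 2) = P.eval u := by
    simp only [hP, equilibriumRateSlope, Polynomial.eval_finsetSum, Polynomial.eval_mul,
      Polynomial.eval_pow, Polynomial.eval_add, Polynomial.eval_X, Polynomial.eval_C, add_comm]
  have h1 : ∀ Q : Polynomial ℝ, Q.eval u = Q.divX.eval u * u + Q.coeff 0 := fun Q => by
    conv_lhs => rw [← Q.divX_mul_X_add]
    simp
  rw [heval, h1 P, h1 P.divX, h1 P.divX.divX]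
  simp only [Polynomial.coeff_divX]
  ring

/-! ### The co-moving system -/

theorem coMovingField_eq_zero_iff {N : ℕ} {ε r : ℝ} (hε : 0 < ε) (q : ℝ × ℝ) :
    coMovingField N ε r q = 0 ↔ equilibriumRate N q.1 = r ∧ q.2 = q.1 * (1 - q.1) := by
  rw [Prod.ext_iff]
  simp only [coMovingField, equilibriumRate, Prod.fst_zero, Prod.snd_zero, div_eq_zero_iff, hε.ne',
    or_false]
  constructor
  · rintro ⟨h1, h2⟩
    exact ⟨by linarith, by linarith⟩
  · rintro ⟨h1, h2⟩
    exact ⟨by rw [h2]; ring, by linarith⟩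

theorem existsUnique_coMovingField_eq_zero {N : ℕ} (hN : Odd N) {ε : ℝ} (hε : 0 < ε) (r : ℝ) :
    ∃! q : ℝ × ℝ, coMovingField N ε r q = 0 := by
  obtain ⟨x, hx⟩ := surjective_equilibriumRate hN r
  refine ⟨(x, x * (1 - x)), (coMovingField_eq_zero_iff hε _).2 ⟨hx, rfl⟩, fun q hq => ?_⟩
  obtain ⟨h1, h2⟩ := (coMovingField_eq_zero_iff hε _).1 hq
  have h3 := (strictMono_equilibriumRate hN).injective (h1.trans hx.symm)
  exact Prod.ext h3 (by rw [h2, h3])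

/-- Relative to its equilibrium, the co-moving system is a Liénard system. -/
theorem coMovingField_add (N : ℕ) (ε x : ℝ) (p : ℝ × ℝ) :
    coMovingField N ε (equilibriumRate N x) ((x, x * (1 - x)) + p) =
      lienardField ε (2 * x - 1) (fun u => equilibriumRateSlope N (x + u) x) p := by
  have h := equilibriumRateSlope_mul_sub N (x + p.1) x
  rw [add_sub_cancel_left] at h
  ext
  · simp only [coMovingField, lienardField, Prod.fst_add, Prod.snd_add]
    ring
  · simp only [coMovingField, lienardField, Prod.fst_add]
    rw [mul_comm, h]
    simp only [equilibriumRate]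
    ring

theorem contDiff_coMovingField (N : ℕ) (ε : ℝ) :
    ContDiff ℝ ∞ fun p : ℝ × (ℝ × ℝ) => coMovingField N ε p.1 p.2 := by
  unfold coMovingField
  fun_prop

/-- For rates slightly above the critical one there are small periodic orbits. -/
theorem eventually_hasPeriodicOrbitIn_coMovingField {N : ℕ} (hN : Odd N) (hN2 : 2 ≤ N) {ε : ℝ}
    (hε : 0 < ε) {U : Set (ℝ × ℝ)} (hU : U ∈ 𝓝 ((1 / 2, 1 / 4) : ℝ × ℝ)) :
    ∀ᶠ r in 𝓝[>] criticalRate N, HasPeriodicOrbitIn (coMovingField N ε r) U := by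
  obtain ⟨X, hX, hX', hmono, hXC, -⟩ := exists_inverse_equilibriumRate hN
  have hXc : X (criticalRate N) = 1 / 2 := hX' (1 / 2)
  obtain ⟨a, b, c, h, ha, hb, hh, hg0⟩ := exists_equilibriumRateSlope_expansion hN2
  obtain ⟨ρ, hρ, hρU⟩ := Metric.nhds_basis_closedBall.mem_iff.1 hU
  have hg : ContDiff ℝ 1 (Function.uncurry fun m u : ℝ =>
      equilibriumRateSlope N (1 / 2 + m / 2 + u) (1 / 2 + m / 2)) :=
    (contDiff_equilibriumRateSlope N).comp (by fun_prop :
      ContDiff ℝ 1 fun x : ℝ × ℝ => (1 / 2 + x.1 / 2 + x.2, 1 / 2 + x.1 / 2))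
  have hper := eventually_hasPeriodicOrbitIn_lienard hε ha hb hg hh
    (fun u => by simpa using hg0 u) (half_pos hρ)
  -- The Liénard parameter at the equilibrium for the rate `r`.
  have hm : Tendsto (fun r => 2 * X r - 1) (𝓝[>] criticalRate N) (𝓝[>] 0) := by
    refine tendsto_nhdsWithin_iff.2 ⟨?_, ?_⟩
    · have : Tendsto (fun r => 2 * X r - 1) (𝓝 (criticalRate N)) (𝓝 0) :=
        ((hXC.continuous.const_mul 2).sub continuous_const).tendsto' _ _
          (by simp [hXc])
      exact this.mono_left nhdsWithin_le_nhds
    · filter_upwards [self_mem_nhdsWithin] with r hr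
      have : X (criticalRate N) < X r := hmono hr
      rw [hXc] at this
      exact mem_Ioi.2 (by linarith)
  have hcen : ∀ᶠ r in 𝓝[>] criticalRate N,
      (X r, X r * (1 - X r)) ∈ Metric.closedBall ((1 / 2, 1 / 4) : ℝ × ℝ) (ρ / 2) := by
    have hc : Continuous fun r => (X r, X r * (1 - X r)) := by
      have := hXC.continuous
      fun_prop
    refine (hc.tendsto' _ _ ?_).mono_left nhdsWithin_le_nhds
      (Metric.closedBall_mem_nhds _ (half_pos hρ))
    rw [hXc]
    norm_num
  filter_upwards [hm.eventually hper, hcen] with r hr hc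
  refine hr.translate (X r, X r * (1 - X r)) (fun p => ?_) fun p hp => hρU ?_
  · have h1 := coMovingField_add N ε (X r) p
    have h2 : 1 / 2 + (2 * X r - 1) / 2 = X r := by ring
    rw [hX] at h1
    rw [h1, h2]
  · have h1 := mem_closedBall_zero_of_sq_add_sq_le (half_pos hρ).le hp
    rw [mem_closedBall_zero_iff] at h1
    rw [mem_closedBall_iff_norm] at hc ⊢
    rw [add_sub_right_comm]
    exact (norm_add_le _ _).trans (by linarith)

/-- To the left of `x = 1 / 2` the trace of the Jacobian is negative and the equilibrium is
asymptotically stable. -/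
theorem isAsymptoticallyStable_coMovingField {N : ℕ} (hN : Odd N) {ε : ℝ} (hε : 0 < ε) {x : ℝ}
    (hx : x < 1 / 2) :
    IsAsymptoticallyStable (coMovingField N ε (equilibriumRate N x)) (x, x * (1 - x)) := by
  set q : ℝ × ℝ := (x, x * (1 - x)) with hq
  set a := equilibriumRateDeriv N x
  have ha : 0 < a := equilibriumRateDeriv_pos hN x
  have hm : 2 * x - 1 < 0 := by linarith
  have hg : Continuous fun u => equilibriumRateSlope N (x + u) x :=
    (contDiff_equilibriumRateSlope N).continuous.comp
      (by fun_prop : Continuous fun u : ℝ => (x + u, x))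
  obtain ⟨l, k, hk, R, hR, hV⟩ := exists_lienardQuadratic_bounds hε ha hm.ne hg
    (by rw [add_zero, equilibriumRateSlope_self])
  set C : ℝ := a * ε / 2 + 1 / 2 + |l| with hC
  have hCpos : 0 < C := by positivity
  have hsq : ∀ p ∈ Metric.closedBall q (R / 2), (p - q).1 ^ 2 + (p - q).2 ^ 2 ≤ R ^ 2 := by
    intro p hp
    rw [mem_closedBall_iff_norm, Prod.norm_def, max_le_iff, Real.norm_eq_abs, Real.norm_eq_abs]
      at hp
    have h1 := sq_le_sq' (abs_le.1 hp.1).1 (abs_le.1 hp.1).2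
    have h2 := sq_le_sq' (abs_le.1 hp.2).1 (abs_le.1 hp.2).2
    nlinarith
  have hdiff := (contDiff_lienardQuadratic ε a l).differentiable one_ne_zero
  refine isAsymptoticallyStable_of_lyapunov (V := fun p => lienardQuadratic ε a l (p - q))
    (k := k) (κ := k / (-(2 * x - 1) * C)) (R := R / 2) ?_
    ((coMovingField_eq_zero_iff hε _).2 ⟨rfl, rfl⟩) (hdiff.comp (differentiable_id.sub_const q))
    (by simp [lienardQuadratic]) hk (div_pos hk (mul_pos (neg_pos.2 hm) hCpos)) (half_pos hR)
    (fun p hp => ?_) fun p hp => ?_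
  · exact ((contDiff_coMovingField N ε).comp (contDiff_const.prodMk contDiff_id)).of_le (by simp)
  · refine le_trans ?_ (hV _ (hsq p hp)).1
    refine mul_le_mul_of_nonneg_left ?_ hk.le
    rw [Prod.norm_def]
    rcases max_choice ‖(p - q).1‖ ‖(p - q).2‖ with h | h <;>
      rw [h, Real.norm_eq_abs, sq_abs]
    · linarith [sq_nonneg (p - q).2]
    · linarith [sq_nonneg (p - q).1]
  · have h1 := (hV _ (hsq p hp)).2
    have h2 : coMovingField N ε (equilibriumRate N x) p = lienardField ε (2 * x - 1)
        (fun u => equilibriumRateSlope N (x + u) x) (p - q) := by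
      rw [← coMovingField_add, ← hq, add_sub_cancel]
    have h3 : fderiv ℝ (fun p => lienardQuadratic ε a l (p - q)) p =
        fderiv ℝ (lienardQuadratic ε a l) (p - q) :=
      ((hdiff _).hasFDerivAt.comp p ((hasFDerivAt_id p).sub_const q)).fderiv
    rw [h3, h2]
    set d := fderiv ℝ (lienardQuadratic ε a l) (p - q) (lienardField ε (2 * x - 1)
        (fun u => equilibriumRateSlope N (x + u) x) (p - q))
    have h4 : lienardQuadratic ε a l (p - q) ≤ C * ((p - q).1 ^ 2 + (p - q).2 ^ 2) := by
      generalize p - q = z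
      obtain ⟨u, v⟩ := z
      have h5 : |u * v| ≤ u ^ 2 + v ^ 2 := by
        rw [abs_le]
        constructor <;> nlinarith [sq_nonneg (u + v), sq_nonneg (u - v)]
      have h6 : l * (u * v) ≤ |l| * (u ^ 2 + v ^ 2) := by
        refine (le_abs_self _).trans ?_
        rw [abs_mul]
        exact mul_le_mul_of_nonneg_left h5 (abs_nonneg l)
      have h7 : 0 ≤ a * ε / 2 * v ^ 2 := by positivity
      have h8 := sq_nonneg u
      simp only [lienardQuadratic, hC]
      linarith
    have h5 : k / (-(2 * x - 1) * C) * lienardQuadratic ε a l (p - q) ≤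
        k * ((p - q).1 ^ 2 + (p - q).2 ^ 2) / -(2 * x - 1) := by
      refine (mul_le_mul_of_nonneg_left h4
        (div_pos hk (mul_pos (neg_pos.2 hm) hCpos)).le).trans_eq ?_
      have : -(2 * x - 1) ≠ 0 := (neg_pos.2 hm).ne'
      field_simp
    have h6 : k * ((p - q).1 ^ 2 + (p - q).2 ^ 2) / -(2 * x - 1) ≤ -d := by
      rw [div_le_iff₀ (neg_pos.2 hm)]
      linarith
    linarith

/-! ### Eigenvalues of the Jacobian -/

/-- The eigenvalues of the Jacobian of a planar field are determined by its trace and its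
determinant; here they are assumed to form a complex conjugate pair `z`, `conj z`. -/
theorem jacobianEigenvalues_eq_pair {v : ℝ × ℝ → ℝ × ℝ} {q : ℝ × ℝ} {f : ℝ × ℝ →L[ℝ] ℝ × ℝ}
    (hv : HasFDerivAt v f q) {z : ℂ} (htr : (f (1, 0)).1 + (f (0, 1)).2 = 2 * z.re)
    (hdet : (f (1, 0)).1 * (f (0, 1)).2 - (f (0, 1)).1 * (f (1, 0)).2 = z.re ^ 2 + z.im ^ 2) :
    jacobianEigenvalues v q = {z, starRingEnd ℂ z} := by
  have hchar : LinearMap.charpoly (f : ℝ × ℝ →ₗ[ℝ] ℝ × ℝ) =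
      Polynomial.X ^ 2 - Polynomial.C (2 * z.re) * Polynomial.X +
        Polynomial.C (z.re ^ 2 + z.im ^ 2) := by
    rw [← LinearMap.charpoly_toMatrix _ (Module.Basis.finTwoProd ℝ), Matrix.charpoly_fin_two,
      Matrix.trace_fin_two, Matrix.det_fin_two]
    simp only [LinearMap.toMatrix_apply, Module.Basis.finTwoProd_zero,
      Module.Basis.finTwoProd_one, Module.Basis.coe_finTwoProd_repr, ContinuousLinearMap.coe_coe,
      Matrix.cons_val_zero, Matrix.cons_val_one]
    rw [htr, hdet]
  have hadd : (z + starRingEnd ℂ z : ℂ) = ((2 * z.re : ℝ) : ℂ) := Complex.add_conj z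
  have hmul : (z * starRingEnd ℂ z : ℂ) = ((z.re ^ 2 + z.im ^ 2 : ℝ) : ℂ) := by
    rw [Complex.mul_conj, Complex.normSq_apply, sq, sq]
  have hfac : (LinearMap.charpoly (f : ℝ × ℝ →ₗ[ℝ] ℝ × ℝ)).map (algebraMap ℝ ℂ) =
      (Polynomial.X - Polynomial.C z) * (Polynomial.X - Polynomial.C (starRingEnd ℂ z)) := by
    rw [hchar]
    simp only [Polynomial.map_add, Polynomial.map_sub, Polynomial.map_mul, Polynomial.map_pow,
      Polynomial.map_X, Polynomial.map_C, Complex.coe_algebraMap]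
    rw [← hadd, ← hmul, Polynomial.C_add, Polynomial.C_mul]
    ring
  rw [jacobianEigenvalues, hv.fderiv, hfac, Polynomial.roots_mul
    (mul_ne_zero (Polynomial.X_sub_C_ne_zero _) (Polynomial.X_sub_C_ne_zero _)),
    Polynomial.roots_X_sub_C, Polynomial.roots_X_sub_C]
  rfl

theorem hasFDerivAt_coMovingField (N : ℕ) (ε r : ℝ) (q : ℝ × ℝ) :
    ∃ f : ℝ × ℝ →L[ℝ] ℝ × ℝ, HasFDerivAt (coMovingField N ε r) f q ∧
      f (1, 0) = ((2 * q.1 - 1) / ε, -equilibriumRateDeriv N q.1) ∧ f (0, 1) = (1 / ε, 0) := by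
  have hu := hasFDerivAt_fst (𝕜 := ℝ) (p := q)
  have hv := hasFDerivAt_snd (𝕜 := ℝ) (p := q)
  have h1 := (hv.add (hu.mul (hu.sub_const 1))).mul_const ε⁻¹
  have h2 := ((hasDerivAt_equilibriumRate N q.1).comp_hasFDerivAt q hu).neg.add_const r
  have h3 : HasFDerivAt (coMovingField N ε r) _ q := h1.prodMk h2
  refine ⟨_, h3, ?_, ?_⟩
  · ext
    · simp
      ring
    · simp
  · ext <;> simp

/-- When the discriminant is not positive, the eigenvalues are the complex numbers with real part
half the trace and squared absolute value the determinant. -/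
theorem jacobianEigenvalues_coMovingField {N : ℕ} {ε r : ℝ} {q : ℝ × ℝ}
    (h : ((2 * q.1 - 1) / (2 * ε)) ^ 2 ≤ equilibriumRateDeriv N q.1 / ε) :
    jacobianEigenvalues (coMovingField N ε r) q =
      {⟨(2 * q.1 - 1) / (2 * ε),
          √(equilibriumRateDeriv N q.1 / ε - ((2 * q.1 - 1) / (2 * ε)) ^ 2)⟩,
        starRingEnd ℂ ⟨(2 * q.1 - 1) / (2 * ε),
          √(equilibriumRateDeriv N q.1 / ε - ((2 * q.1 - 1) / (2 * ε)) ^ 2)⟩} := by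
  obtain ⟨f, hf, h1, h2⟩ := hasFDerivAt_coMovingField N ε r q
  refine jacobianEigenvalues_eq_pair hf ?_ ?_
  · rw [h1, h2]
    ring
  · rw [h1, h2, Real.sq_sqrt (sub_nonneg.2 h)]
    ring

theorem jacobianEigenvalues_coMovingField_half {N : ℕ} (hN : Odd N) {ε : ℝ} (hε : 0 < ε) (r : ℝ) :
    jacobianEigenvalues (coMovingField N ε r) (1 / 2, 1 / 4) =
      {(√(equilibriumRateDeriv N (1 / 2) / ε) : ℂ) * Complex.I,
        -((√(equilibriumRateDeriv N (1 / 2) / ε) : ℂ) * Complex.I)} := by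
  have hpos : 0 < equilibriumRateDeriv N (1 / 2) / ε := div_pos (equilibriumRateDeriv_pos hN _) hε
  rw [jacobianEigenvalues_coMovingField (by simpa using hpos.le)]
  congr 1
  · apply Complex.ext <;> simp
  · congr 1
    apply Complex.ext <;> simp

/-! ### The Hopf bifurcation -/

theorem isHopfBifurcation_coMovingField {N : ℕ} (hN : Odd N) (hN2 : 2 ≤ N) {ε : ℝ} (hε : 0 < ε) :
    IsHopfBifurcation (coMovingField N ε) (criticalRate N) (1 / 2, 1 / 4) where
  smooth := (contDiff_coMovingField N ε).contDiffAt
  crossing := by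
    obtain ⟨X, hX, hX', -, hXC, hXd⟩ := exists_inverse_equilibriumRate hN
    have hXc : X (criticalRate N) = 1 / 2 := hX' (1 / 2)
    have hpos : 0 < equilibriumRateDeriv N (1 / 2) / ε :=
      div_pos (equilibriumRateDeriv_pos hN _) hε
    set b := √(equilibriumRateDeriv N (1 / 2) / ε) with hb
    have hbpos : 0 < b := Real.sqrt_pos.2 hpos
    have heig := jacobianEigenvalues_coMovingField_half hN hε (criticalRate N)
    rw [← hb] at heig
    have hne : (b : ℂ) * Complex.I ≠ -(b * Complex.I) := by
      intro h
      have := congrArg Complex.im h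
      simp at this
      linarith
    -- The real part and the squared imaginary part of the eigenvalues along the branch.
    set ρ : ℝ → ℝ := fun r => (2 * X r - 1) / (2 * ε) with hρ
    set δ : ℝ → ℝ := fun r => equilibriumRateDeriv N (X r) / ε - ρ r ^ 2 with hδ
    have hδC : ContDiff ℝ ∞ δ :=
      (((contDiff_equilibriumRateDeriv N).comp hXC).div_const ε).sub
        ((((contDiff_const.mul hXC).sub contDiff_const).div_const _).pow 2)
    have hρc : ρ (criticalRate N) = 0 := by simp [hρ, hXc]
    have hδc : δ (criticalRate N) = equilibriumRateDeriv N (1 / 2) / ε := by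
      simp only [hδ, hρc, hXc]
      ring
    have hρd : HasDerivAt ρ
        (2 * (equilibriumRateDeriv N (X (criticalRate N)))⁻¹ / (2 * ε)) (criticalRate N) :=
      (((hXd _).const_mul 2).sub_const 1).div_const _
    have hσd := ((hδC.differentiable (by simp)) (criticalRate N)).hasDerivAt.sqrt
      (by rw [hδc]; exact hpos.ne')
    refine ⟨b, fun r => (X r, X r * (1 - X r)), fun r => (ρ r : ℂ) + (√(δ r) : ℂ) * Complex.I, _,
      hbpos, ?_, ?_, ?_, ?_, ?_, hρd.ofReal_comp.add (hσd.ofReal_comp.mul_const Complex.I), ?_,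
      ?_, ?_, ?_⟩
    · simp only [hXc]
      norm_num
    · exact (hXC.prodMk (hXC.mul (contDiff_const.sub hXC))).contDiffAt
    · exact Eventually.of_forall fun r => (coMovingField_eq_zero_iff hε _).2 ⟨hX r, rfl⟩
    · simp [hρc, hδc, hb]
    · have hev : ∀ᶠ r in 𝓝 (criticalRate N), 0 < δ r :=
        hδC.continuous.continuousAt.eventually_const_lt (by rw [hδc]; exact hpos)
      filter_upwards [hev] with r hr
      rw [jacobianEigenvalues_coMovingField (sub_pos.1 hr).le, Multiset.insert_eq_cons,
        Multiset.mem_cons]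
      left
      exact (Complex.mk_eq_add_mul_I _ _).symm
    · have h1 := equilibriumRateDeriv_pos hN (X (criticalRate N))
      rw [Complex.add_re, Complex.ofReal_re, Complex.re_ofReal_mul, Complex.I_re, mul_zero, add_zero]
      positivity
    · rw [heig, Multiset.insert_eq_cons, Multiset.count_cons_self, Multiset.count_singleton,
        if_neg hne]
    · rw [heig, Multiset.insert_eq_cons, Multiset.count_cons_of_ne hne.symm,
        Multiset.count_singleton_self]
    · intro z hz _
      rw [heig] at hz
      simpa using hz
  periodic_orbits :=
    Or.inl fun _ hU => eventually_hasPeriodicOrbitIn_coMovingField hN hN2 hε hU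

theorem mainTheorem1 (N : ℕ) (hN : Odd N) (hN5 : 5 ≤ N) (ε : ℝ) (hε : 0 < ε) :
    -- there is a unique equilibrium for each value of the rate
    (∀ r : ℝ, ∃! q : ℝ × ℝ, coMovingField N ε r q = 0) ∧
    -- Hopf bifurcation at the critical rate, from the equilibrium at the fold
    IsHopfBifurcation (coMovingField N ε) (criticalRate N) (1 / 2, 1 / 4) ∧
    -- the small periodic orbits exist above the critical rate
    (∀ U ∈ 𝓝 ((1 / 2, 1 / 4) : ℝ × ℝ), ∀ᶠ r in 𝓝[>] criticalRate N,
      HasPeriodicOrbitIn (coMovingField N ε r) U) ∧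
    -- the eigenvalues at the critical rate
    jacobianEigenvalues (coMovingField N ε (criticalRate N)) (1 / 2, 1 / 4) =
      {(√((∑ n ∈ Finset.Icc 1 N, (n : ℝ) * (1 / 2) ^ (n - 1)) / ε) : ℂ) * Complex.I,
        -((√((∑ n ∈ Finset.Icc 1 N, (n : ℝ) * (1 / 2) ^ (n - 1)) / ε) : ℂ) * Complex.I)} ∧
    -- below the critical rate the equilibrium has `x₁ < 1 / 2` and is asymptotically stable
    (∀ r : ℝ, r < criticalRate N → ∀ q : ℝ × ℝ, coMovingField N ε r q = 0 →
      q.1 < 1 / 2 ∧ IsAsymptoticallyStable (coMovingField N ε r) q) := by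
  have hN2 : 2 ≤ N := by omega
  refine ⟨existsUnique_coMovingField_eq_zero hN hε, isHopfBifurcation_coMovingField hN hN2 hε,
    fun U hU => eventually_hasPeriodicOrbitIn_coMovingField hN hN2 hε hU,
    jacobianEigenvalues_coMovingField_half hN hε _, fun r hr q hq => ?_⟩
  obtain ⟨rfl, hq2⟩ := (coMovingField_eq_zero_iff hε q).1 hq
  have hlt : q.1 < 1 / 2 := (strictMono_equilibriumRate hN).lt_iff_lt.1 hr
  have h := isAsymptoticallyStable_coMovingField hN hε hlt
  rw [← hq2] at h
  exact ⟨hlt, h⟩
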